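/- All graphs are finite and simple. A graph is planar if it can be drawn in the plane without crossings. A triangle is a cycle of length $3$ and a $4$-cycle is a cycle of length $4$, cycles being regarded as subgraphs. Two cycles are intersecting if they have at least one common vertex, and adjacent if they have a common edge. A graph $G$ is adaptably $k$-choosable if for every (possibly improper) edge coloring $F: E(G)\to\mathbb{Z}$ and every assignment of lists $L(v)\subset\mathbb{Z}$ with $|L(v)|\ge k$ to the vertices there is a (possibly improper) vertex coloring $c$ with $c(v)\in L(v)$ for all $v\in V(G)$ such that no edge $uv$ satisfies $c(u)=c(v)=F(uv)$. The adaptable choice number $\mathrm{ch}_{ad}(G)$ is the smallest $k$ such that $G$ is adaptably $k$-choosable. A graph $G$ is $(k,d)$-choosable if for every assignment of lists with $|L(v)|\ge k$ for every vertex $v$ and $|L(u)\cap L(v)|\le d$ for every edge $uv$ there is a proper vertex coloring $c$ with $c(v)\in L(v)$ for all $v$. Theorem. Let $G$ be a planar graph in which no two distinct triangles are intersecting and every triangle is adjacent to at most one $4$-cycle. Then $\mathrm{ch}_{ad}(G)\le 3$, and $G$ is $(3,1)$-choosable. -/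

import Mathlib

namespace SimpleGraph

variable {V : Type*}

/-! ### Planar graphs -/

/-- `A` is a polygonal arc in the plane with end points `x` and `y`: it is the union of the
segments `[p 0, p 1], …, [p (n - 1), p n]` of a polygonal path from `x = p 0` to `y = p n` that
never meets itself: consecutive segments share only their common corner, and segments that are
not consecutive are disjoint. -/
def IsPolygonalArc (A : Set (ℝ × ℝ)) (x y : ℝ × ℝ) : Prop :=
  ∃ (n : ℕ) (p : ℕ → ℝ × ℝ), 0 < n ∧ p 0 = x ∧ p n = y ∧
    A = (⋃ i : Fin n, segment ℝ (p i) (p (i + 1))) ∧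
    (∀ i, i < n → p i ≠ p (i + 1)) ∧
    (∀ i, i + 1 < n →
      segment ℝ (p i) (p (i + 1)) ∩ segment ℝ (p (i + 1)) (p (i + 2)) = {p (i + 1)}) ∧
    (∀ i j, i + 1 < j → j < n →
      Disjoint (segment ℝ (p i) (p (i + 1))) (segment ℝ (p j) (p (j + 1))))

/-- A drawing of `G` in the plane without crossings: vertices are distinct points, every edge is
a polygonal arc joining its two end vertices and containing no other vertex, and two distinct
edges meet at most in common end vertices. (The values of `arc` at pairs that are not edges of
`G` play no role.) -/
structure PlaneDrawing (G : SimpleGraph V) where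
  point : V → ℝ × ℝ
  arc : Sym2 V → Set (ℝ × ℝ)
  point_injective : Function.Injective point
  isPolygonalArc_arc : ∀ u v, G.Adj u v → IsPolygonalArc (arc s(u, v)) (point u) (point v)
  mem_of_point_mem_arc : ∀ e ∈ G.edgeSet, ∀ v, point v ∈ arc e → v ∈ e
  exists_of_mem_arc_inter : ∀ e ∈ G.edgeSet, ∀ f ∈ G.edgeSet, e ≠ f →
    ∀ z ∈ arc e ∩ arc f, ∃ v, v ∈ e ∧ v ∈ f ∧ point v = z

/-- A graph is planar if it can be drawn in the plane without crossings. -/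
def IsPlanar (G : SimpleGraph V) : Prop :=
  Nonempty G.PlaneDrawing

/-! ### Cycles as subgraphs -/

/-- The subgraph `C` of `G` is a cycle of length `n`, for short an `n`-cycle. -/
def IsCycleOfLength {G : SimpleGraph V} (C : G.Subgraph) (n : ℕ) : Prop :=
  ∃ (v : V) (w : G.Walk v v), w.IsCycle ∧ w.length = n ∧ w.toSubgraph = C

/-- A triangle of `G` is a cycle of length three. -/
def IsTriangle {G : SimpleGraph V} (T : G.Subgraph) : Prop :=
  IsCycleOfLength T 3

/-- Two cycles (more generally, subgraphs) are intersecting if they have a common vertex. -/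
def Intersecting {G : SimpleGraph V} (C D : G.Subgraph) : Prop :=
  (C.verts ∩ D.verts).Nonempty

/-- Two cycles (more generally, subgraphs) are adjacent if they have a common edge. -/
def AdjacentCycles {G : SimpleGraph V} (C D : G.Subgraph) : Prop :=
  (C.edgeSet ∩ D.edgeSet).Nonempty

/-- No two distinct triangles of `G` are intersecting. -/
def NoIntersectingTriangles (G : SimpleGraph V) : Prop :=
  ∀ S T : G.Subgraph, IsTriangle S → IsTriangle T → S ≠ T → ¬ Intersecting S T

/-- Every triangle of `G` is adjacent to at most one `4`-cycle. -/
def TrianglesAdjacentToAtMostOneFourCycle (G : SimpleGraph V) : Prop :=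
  ∀ T : G.Subgraph, IsTriangle T →
    ∀ C D : G.Subgraph, IsCycleOfLength C 4 → IsCycleOfLength D 4 →
      AdjacentCycles T C → AdjacentCycles T D → C = D

/-! ### Adapted colorings and choosability; colors are integers -/

/-- The (possibly improper) vertex coloring `c` is adapted to the (possibly improper) edge
coloring `F`: no edge has the same color as both of its end vertices. -/
def IsAdapted (G : SimpleGraph V) (F : G.EdgeLabeling ℤ) (c : V → ℤ) : Prop :=
  ∀ (u v : V) (h : G.Adj u v), c u ≠ c v ∨ c v ≠ F ⟨s(u, v), h⟩

/-- `G` is adaptably `k`-choosable: for every edge coloring `F` and all lists `L v` of at least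
`k` colors there is a coloring from the lists that is adapted to `F`. -/
def AdaptablyChoosable (G : SimpleGraph V) (k : ℕ) : Prop :=
  ∀ (F : G.EdgeLabeling ℤ) (L : V → Finset ℤ), (∀ v, k ≤ (L v).card) →
    ∃ c : V → ℤ, G.IsAdapted F c ∧ ∀ v, c v ∈ L v

/-- The adaptable choice number of `G`: the smallest `k` such that `G` is adaptably
`k`-choosable (and `⊤` if there is no such `k`). -/
noncomputable def adaptableChoiceNumber (G : SimpleGraph V) : ℕ∞ :=
  ⨅ k ∈ {k : ℕ | G.AdaptablyChoosable k}, (k : ℕ∞)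

/-- `G` is `(k, d)`-choosable: whenever every vertex has a list of at least `k` colors and the
lists of any two adjacent vertices have at most `d` common colors, there is a proper coloring
from the lists. -/
def SeparatedChoosable (G : SimpleGraph V) (k d : ℕ) : Prop :=
  ∀ L : V → Finset ℤ, (∀ v, k ≤ (L v).card) →
    (∀ u v, G.Adj u v → (L u ∩ L v).card ≤ d) →
    ∃ c : G.Coloring ℤ, ∀ v, c v ∈ L v

end SimpleGraph

/-!
A drawing of `G` yields, at every vertex, the cyclic order of the edges leaving it, and so a
rotation system on the darts whose faces are the cycles of `d ↦ σ d.symm`. The winding number of a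
circulation around a point of the plane is locally constant off the drawing and jumps by the flow
across each edge, so every circulation is a difference of values on faces; comparing dimensions
gives Euler's inequality `|E| + 2 ≤ |V| + |F|`.

If all degrees are at least three, faces of length three are surrounded by longer faces, no two
consecutive sides of a face lead to faces of length three, and at least one of any two
consecutive sides of a face of length three leads to a face of length at least five. Give a face
of length `l` the charge `2 l - 8`; letting each face of length at least five send one unit across
every side shared with a face of length three makes all charges nonnegative, so `4 |F| ≤ 2 |E|` and
`|E| < 2 |V|`. Removing vertices of degree at most two, `|E| ≤ 2 |V|` follows for every graph of
the class, in particular for all induced subgraphs. Hall's theorem then assigns every edge to one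
of its ends with at most two edges at each vertex, and a list of three colours contains one that
does not occur on these two edges.
-/

open Filter Topology Set
open scoped Real

/-! ### Angles -/

lemma comp_eq_of_isPreconnected {X Y Z : Type*} [TopologicalSpace X] [TopologicalSpace Y]
    {f : Y → Z} {K : Set Y} (hf : ∀ y ∉ K, ∀ᶠ z in 𝓝 y, f z = f y) {φ : X → Y} {U : Set X}
    (hU : IsPreconnected U) (hφ : ContinuousOn φ U) (hK : ∀ x ∈ U, φ x ∉ K) {x y : X}
    (hx : x ∈ U) (hy : y ∈ U) : f (φ x) = f (φ y) :=
  hU.induction₂ (fun x y => f (φ x) = f (φ y))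
    (fun x hx => ((hφ x hx).eventually (hf _ (hK x hx))).mono fun _ h => h.symm)
    (fun _ _ _ _ _ _ h₁ h₂ => h₁.trans h₂) (fun _ _ _ _ h => h.symm) hx hy

lemma eventually_eq_of_coe_angle_eq {X : Type*} [TopologicalSpace X] {f g : X → ℝ} {x₀ : X}
    (hf : ContinuousAt f x₀) (hg : ContinuousAt g x₀) (h₀ : f x₀ = g x₀)
    (h : ∀ᶠ x in 𝓝 x₀, (f x : Real.Angle) = g x) : ∀ᶠ x in 𝓝 x₀, f x = g x := by
  have hsmall : ∀ᶠ x in 𝓝 x₀, |f x - g x| < 2 * π :=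
    (hf.sub hg).abs.eventually_lt_const (by simpa [h₀] using Real.pi_pos)
  filter_upwards [h, hsmall] with x hx hlt
  obtain ⟨k, hk⟩ := Real.Angle.angle_eq_iff_two_pi_dvd_sub.1 hx
  rw [hk, abs_mul, abs_of_pos Real.two_pi_pos, mul_lt_iff_lt_one_right Real.two_pi_pos] at hlt
  have hk0 : k = 0 := Int.abs_lt_one_iff.1 (by exact_mod_cast hlt)
  rwa [hk0, Int.cast_zero, mul_zero, sub_eq_zero] at hk

/-- The oriented angle in `(-π, π]` under which the segment from `a` to `b` is seen from `x`. -/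
noncomputable def subtendedAngle (a b x : ℂ) : ℝ := Complex.arg ((b - x) / (a - x))

lemma ne_of_notMem_segment {a b x : ℂ} (h : x ∉ segment ℝ a b) : a - x ≠ 0 ∧ b - x ≠ 0 :=
  ⟨fun h₀ => h (sub_eq_zero.1 h₀ ▸ left_mem_segment ℝ a b),
    fun h₀ => h (sub_eq_zero.1 h₀ ▸ right_mem_segment ℝ a b)⟩

lemma div_mem_slitPlane_of_notMem_segment {a b x : ℂ} (h : x ∉ segment ℝ a b) :
    (b - x) / (a - x) ∈ Complex.slitPlane := by
  by_contra hc
  obtain ⟨r, hr, hz⟩ : ∃ r : ℝ, 0 ≤ r ∧ (b - x) / (a - x) = -r := by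
    rw [Complex.mem_slitPlane_iff_not_le_zero, not_not, Complex.le_def] at hc
    exact ⟨-((b - x) / (a - x)).re, by simpa using hc.1, by
      apply Complex.ext
      · simp
      · simpa using hc.2⟩
  rw [div_eq_iff (ne_of_notMem_segment h).1] at hz
  have hr1 : (1 + r : ℂ) ≠ 0 := by exact_mod_cast (by positivity : 1 + r ≠ 0)
  refine h ⟨r / (1 + r), 1 / (1 + r), by positivity, by positivity, by field_simp; ring, ?_⟩
  simp only [Complex.real_smul]
  push_cast
  field_simp
  linear_combination hz

lemma continuousAt_arg_sub_div {c x₀ : ℂ} (h : c - x₀ ≠ 0) :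
    ContinuousAt (fun x : ℂ => Complex.arg ((c - x) / (c - x₀))) x₀ := by
  refine ContinuousAt.comp (g := Complex.arg) (Complex.continuousAt_arg ?_) (by fun_prop)
  rw [div_self h]
  exact Complex.one_mem_slitPlane

lemma continuousAt_subtendedAngle {a b x₀ : ℂ} (h : x₀ ∉ segment ℝ a b) :
    ContinuousAt (subtendedAngle a b) x₀ := by
  refine ContinuousAt.comp (g := Complex.arg)
    (Complex.continuousAt_arg (div_mem_slitPlane_of_notMem_segment h)) ?_
  exact ContinuousAt.div (by fun_prop) (by fun_prop) (ne_of_notMem_segment h).1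

lemma eventually_subtendedAngle_sub {a b x₀ : ℂ} (h : x₀ ∉ segment ℝ a b) :
    ∀ᶠ x in 𝓝 x₀, subtendedAngle a b x - subtendedAngle a b x₀ =
      Complex.arg ((b - x) / (b - x₀)) - Complex.arg ((a - x) / (a - x₀)) := by
  obtain ⟨ha, hb⟩ := ne_of_notMem_segment h
  refine eventually_eq_of_coe_angle_eq ((continuousAt_subtendedAngle h).sub continuousAt_const)
    ((continuousAt_arg_sub_div hb).sub (continuousAt_arg_sub_div ha))
    (by simp [div_self ha, div_self hb]) ?_
  have hne {c : ℂ} (hc : c - x₀ ≠ 0) : ∀ᶠ x in 𝓝 x₀, c - x ≠ 0 :=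
    ContinuousAt.eventually_ne (by fun_prop) hc
  filter_upwards [hne ha, hne hb] with x hax hbx
  simp only [subtendedAngle, Real.Angle.coe_sub, Complex.arg_div_coe_angle, ha, hb, hax, hbx,
    ne_eq, not_false_eq_true]
  abel

lemma subtendedAngle_midpoint_add {a b : ℂ} (hab : a ≠ b) (s : ℝ) :
    subtendedAngle a b (midpoint ℝ a b + s * (Complex.I * (b - a))) =
      Complex.arg ((s * Complex.I - 1 / 2) / (s * Complex.I + 1 / 2)) := by
  have hmid : midpoint ℝ a b = (a + b) / 2 := by
    rw [midpoint_eq_smul_add, Complex.real_smul, invOf_eq_inv]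
    push_cast
    ring
  rw [subtendedAngle, hmid,
    ← mul_div_mul_right _ (s * Complex.I + 1 / 2) (neg_ne_zero.2 (sub_ne_zero.2 hab.symm))]
  congr 2 <;> ring

lemma im_jumpQuotient (s : ℝ) :
    ((s * Complex.I - 1 / 2) / (s * Complex.I + 1 / 2)).im = s / (s ^ 2 + 1 / 4) := by
  have hden : (s * Complex.I + 1 / 2 : ℂ) = ⟨1 / 2, s⟩ := by apply Complex.ext <;> simp
  have hnum : (s * Complex.I - 1 / 2 : ℂ) = ⟨-1 / 2, s⟩ := by
    apply Complex.ext <;> norm_num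
  rw [hden, hnum, Complex.div_im, Complex.normSq_mk, ← sub_div]
  congr 1 <;> ring

lemma tendsto_jumpQuotient :
    Tendsto (fun s : ℝ => ((s * Complex.I - 1 / 2) / (s * Complex.I + 1 / 2) : ℂ))
      (𝓝 0) (𝓝 (-1)) := by
  have hcont : ContinuousAt (fun s : ℝ => ((s * Complex.I - 1 / 2) / (s * Complex.I + 1 / 2) : ℂ))
      0 := ContinuousAt.div (by fun_prop) (by fun_prop) (by norm_num)
  convert hcont.tendsto using 2
  norm_num

lemma tendsto_subtendedAngle_left {a b : ℂ} (hab : a ≠ b) :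
    Tendsto (fun s : ℝ => subtendedAngle a b (midpoint ℝ a b + s * (Complex.I * (b - a))))
      (𝓝[>] 0) (𝓝 π) := by
  simp only [subtendedAngle_midpoint_add hab]
  have harg := Complex.continuousWithinAt_arg_of_re_neg_of_im_zero (z := -1) (by simp) (by simp)
  rw [ContinuousWithinAt, Complex.arg_neg_one] at harg
  refine harg.comp (tendsto_nhdsWithin_iff.2 ⟨tendsto_jumpQuotient.mono_left inf_le_left, ?_⟩)
  filter_upwards [self_mem_nhdsWithin] with s hs
  have hs' : 0 < s := hs
  change 0 ≤ Complex.im _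
  rw [im_jumpQuotient]
  positivity

lemma tendsto_subtendedAngle_right {a b : ℂ} (hab : a ≠ b) :
    Tendsto (fun s : ℝ => subtendedAngle a b (midpoint ℝ a b + s * -(Complex.I * (b - a))))
      (𝓝[>] 0) (𝓝 (-π)) := by
  have hflip (s : ℝ) :
      (s * -(Complex.I * (b - a)) : ℂ) = ((-s : ℝ) : ℂ) * (Complex.I * (b - a)) := by
    push_cast
    ring
  have hneg : Tendsto (fun s : ℝ => -s) (𝓝[>] 0) (𝓝 0) :=
    ((continuous_neg.tendsto (0 : ℝ)).mono_left inf_le_left).trans_eq (by rw [neg_zero])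
  simp only [hflip, subtendedAngle_midpoint_add hab]
  refine (Complex.tendsto_arg_nhdsWithin_im_neg_of_re_neg_of_im_zero (z := -1)
    (by simp) (by simp)).comp (tendsto_nhdsWithin_iff.2 ⟨tendsto_jumpQuotient.comp hneg, ?_⟩)
  filter_upwards [self_mem_nhdsWithin] with s hs
  have hs' : 0 < s := hs
  change Complex.im _ < 0
  rw [im_jumpQuotient]
  exact div_neg_of_neg_of_pos (neg_lt_zero.2 hs') (by positivity)

/-! ### The counterclockwise angle between two directions -/

/-- The angle in `(0, 2π]` by which `u` has to be turned counterclockwise to point in the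
direction of `v`; the choice of the interval makes it `2π` for parallel `u` and `v`. -/
noncomputable def ccwAngle (u v : ℂ) : ℝ := toIocMod Real.two_pi_pos 0 (Complex.arg (v / u))

lemma ccwAngle_pos (u v : ℂ) : 0 < ccwAngle u v := left_lt_toIocMod _ _ _

lemma ccwAngle_le (u v : ℂ) : ccwAngle u v ≤ 2 * π :=
  (toIocMod_le_right _ _ _).trans_eq (zero_add _)

lemma coe_ccwAngle (u v : ℂ) : (ccwAngle u v : Real.Angle) = Complex.arg (v / u) :=
  Real.Angle.coe_toIocMod _ _

lemma ccwAngle_eq_of_coe_eq {u v : ℂ} {β : ℝ} (hβ₀ : 0 < β) (hβ : β ≤ 2 * π)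
    (h : (β : Real.Angle) = Complex.arg (v / u)) : ccwAngle u v = β := by
  obtain ⟨k, hk⟩ := Real.Angle.angle_eq_iff_two_pi_dvd_sub.1 h.symm
  refine (toIocMod_eq_iff _).2 ⟨⟨hβ₀, by rwa [zero_add]⟩, k, ?_⟩
  rw [zsmul_eq_mul]
  linarith

lemma ccwAngle_self {u : ℂ} (hu : u ≠ 0) : ccwAngle u u = 2 * π :=
  ccwAngle_eq_of_coe_eq Real.two_pi_pos le_rfl (by simp [div_self hu])

lemma coe_ccwAngle_add {u v w : ℂ} (hu : u ≠ 0) (hv : v ≠ 0) (hw : w ≠ 0) :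
    (ccwAngle u v + ccwAngle v w : Real.Angle) = Complex.arg (w / u) := by
  rw [coe_ccwAngle, coe_ccwAngle, ← Complex.arg_mul_coe_angle (div_ne_zero hv hu)
    (div_ne_zero hw hv), mul_comm, div_mul_div_cancel₀ hv]

lemma ccwAngle_add {u v w : ℂ} (hu : u ≠ 0) (hv : v ≠ 0) (hw : w ≠ 0)
    (h : ccwAngle u v + ccwAngle v w ≤ 2 * π) :
    ccwAngle u w = ccwAngle u v + ccwAngle v w :=
  ccwAngle_eq_of_coe_eq (add_pos (ccwAngle_pos _ _) (ccwAngle_pos _ _)) h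
    (coe_ccwAngle_add hu hv hw)

lemma ccwAngle_add_sub {u v w : ℂ} (hu : u ≠ 0) (hv : v ≠ 0) (hw : w ≠ 0)
    (h : 2 * π < ccwAngle u v + ccwAngle v w) :
    ccwAngle u w = ccwAngle u v + ccwAngle v w - 2 * π := by
  refine ccwAngle_eq_of_coe_eq (sub_pos.2 h) (by linarith [ccwAngle_le u v, ccwAngle_le v w]) ?_
  rw [Real.Angle.coe_sub, Real.Angle.coe_two_pi, sub_zero]
  exact coe_ccwAngle_add hu hv hw

lemma exists_eq_mul_exp_ccwAngle {u v : ℂ} (hu : u ≠ 0) (hv : v ≠ 0) :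
    ∃ r : ℝ, 0 < r ∧ v = r * Complex.exp (ccwAngle u v * Complex.I) * u := by
  have hexp : Complex.exp (ccwAngle u v * Complex.I) =
      Complex.exp (Complex.arg (v / u) * Complex.I) := by
    simpa only [Real.Angle.toCircle_coe, Circle.coe_exp] using
      congrArg (fun θ : Real.Angle => (θ.toCircle : ℂ)) (coe_ccwAngle u v)
  refine ⟨‖v / u‖, norm_pos_iff.2 (div_ne_zero hv hu), ?_⟩
  rw [hexp, Complex.norm_mul_exp_arg_mul_I, div_mul_cancel₀ _ hu]

lemma ccwAngle_eq_of_eq_mul_exp {u v : ℂ} (hu : u ≠ 0) {r β : ℝ} (hr : 0 < r) (hβ₀ : 0 < β)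
    (hβ : β ≤ 2 * π) (hv : v = r * Complex.exp (β * Complex.I) * u) :
    ccwAngle u v = β := by
  refine ccwAngle_eq_of_coe_eq hβ₀ hβ ?_
  rw [hv, mul_div_cancel_right₀ _ hu, Complex.arg_real_mul _ hr, Complex.arg_exp_mul_I,
    Real.Angle.coe_toIocMod]

/-- Among the objects with the same base point `f d` as `d`, turning counterclockwise from the
direction `u d` of `d` first hits the direction of `e`. -/
def IsNextCCW {D V : Type*} (f : D → V) (u : D → ℂ) (d e : D) : Prop :=
  f e = f d ∧ ∀ d', f d' = f d → ccwAngle (u d) (u e) ≤ ccwAngle (u d) (u d')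

/-! ### Systems of segments and their circulations -/

/-- The weights `z` on the edges, each directed from its `tail` to its `head`, satisfy
Kirchhoff's law at every vertex; stated in summed form, against a function `g` on vertices. -/
def IsCirculation {V E : Type*} [Fintype E] (tail head : E → V) (z : E → ℝ) : Prop :=
  ∀ g : V → ℝ, ∑ e, z e * (g (head e) - g (tail e)) = 0

/-- A family of nondegenerate segments in the plane that meet at common end points only. -/
structure SegmentSystem (ι : Type*) where
  a : ι → ℂ
  b : ι → ℂ
  ne : ∀ i, a i ≠ b i
  inter : ∀ i j, i ≠ j → ∀ z ∈ segment ℝ (a i) (b i), z ∈ segment ℝ (a j) (b j) →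
    z = a i ∨ z = b i

/-- The value of `f` at all points close to `x` in direction `v` is `c`. -/
def SideValue (f : ℂ → ℝ) (x v : ℂ) (c : ℝ) : Prop := ∀ᶠ s : ℝ in 𝓝[>] 0, f (x + s * v) = c

lemma SideValue.unique {f : ℂ → ℝ} {x v : ℂ} {c d : ℝ} (hc : SideValue f x v c)
    (hd : SideValue f x v d) : c = d := by
  obtain ⟨s, h₁, h₂⟩ := (hc.and hd).exists
  exact h₁.symm.trans h₂

lemma SideValue.eq_of_tendsto {f : ℂ → ℝ} {x v : ℂ} {c d : ℝ} (hc : SideValue f x v c)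
    (hd : Tendsto (fun s : ℝ => f (x + s * v)) (𝓝[>] 0) (𝓝 d)) : c = d :=
  tendsto_nhds_unique (tendsto_nhds_of_eventually_eq hc) hd

lemma isCompact_segment {E : Type*} [AddCommGroup E] [Module ℝ E] [TopologicalSpace E]
    [IsTopologicalAddGroup E] [ContinuousSMul ℝ E] (x y : E) : IsCompact (segment ℝ x y) := by
  rw [← convexHull_pair]
  exact (Set.toFinite {x, y}).isCompact_convexHull ℝ

lemma eq_zero_of_add_mul_I_mem_segment {p q z : ℂ} (hpq : p ≠ q) (hz : z ∈ segment ℝ p q) {s : ℝ}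
    (hs : z + s * (Complex.I * (q - p)) ∈ segment ℝ p q) : s = 0 := by
  rw [segment_eq_image'] at hz hs
  obtain ⟨t, -, rfl⟩ := hz
  obtain ⟨t', -, ht'⟩ := hs
  have hmul : ((t' : ℂ) - t - s * Complex.I) * (q - p) = 0 := by
    simp only [Complex.real_smul] at ht'
    linear_combination ht'
  simpa using congrArg Complex.im ((mul_eq_zero.1 hmul).resolve_right (sub_ne_zero.2 hpq.symm))

namespace SegmentSystem

variable {ι : Type*} (S : SegmentSystem ι)

/-- The union of all the segments. -/
def carrier : Set ℂ := ⋃ i, segment ℝ (S.a i) (S.b i)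

/-- The weighted sum of the angles under which the segments are seen from `x`, with the full turn
as the unit of angle. -/
noncomputable def potential [Fintype ι] (w : ι → ℝ) (x : ℂ) : ℝ :=
  ∑ i, w i * (subtendedAngle (S.a i) (S.b i) x / (2 * π))

-- Close to `x₀` the angle of a segment varies by a difference of terms at its two end points, and
-- a circulation annihilates such differences.
lemma eventually_potential_eq [Fintype ι] {w : ι → ℝ} (hw : IsCirculation S.a S.b w) {x₀ : ℂ}
    (hx : x₀ ∉ S.carrier) : ∀ᶠ x in 𝓝 x₀, S.potential w x = S.potential w x₀ := by
  have hvar (i : ι) := eventually_subtendedAngle_sub fun h => hx (mem_iUnion.2 ⟨i, h⟩)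
  filter_upwards [eventually_all.2 hvar] with x h
  rw [← sub_eq_zero, potential, potential, ← Finset.sum_sub_distrib,
    ← hw fun v => Complex.arg ((v - x) / (v - x₀)) / (2 * π)]
  refine Finset.sum_congr rfl fun i _ => ?_
  rw [← mul_sub, ← sub_div, h i, sub_div]

/-- The source of an oriented segment; `(i, true)` is the segment from `a i` to `b i`. -/
def src (o : ι × Bool) : ℂ := if o.2 then S.a o.1 else S.b o.1

/-- The target of an oriented segment. -/
def tgt (o : ι × Bool) : ℂ := if o.2 then S.b o.1 else S.a o.1

/-- The direction of an oriented segment. -/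
def dir (o : ι × Bool) : ℂ := S.tgt o - S.src o

/-- The reversed oriented segment. -/
def rev (o : ι × Bool) : ι × Bool := (o.1, !o.2)

/-- Turning counterclockwise around its source, the oriented segment `o₁` first hits `o₂`. -/
abbrev IsNext : ι × Bool → ι × Bool → Prop := IsNextCCW S.src S.dir

lemma src_ne_tgt (o : ι × Bool) : S.src o ≠ S.tgt o := by
  rcases o with ⟨i, _ | _⟩
  exacts [(S.ne i).symm, S.ne i]

lemma dir_ne_zero (o : ι × Bool) : S.dir o ≠ 0 := sub_ne_zero.2 (S.src_ne_tgt o).symm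

lemma dir_rev (o : ι × Bool) : S.dir (rev o) = -S.dir o := by
  rcases o with ⟨i, _ | _⟩ <;> simp [dir, src, tgt, rev]

lemma segment_src_tgt (o : ι × Bool) :
    segment ℝ (S.src o) (S.tgt o) = segment ℝ (S.a o.1) (S.b o.1) := by
  rcases o with ⟨i, _ | _⟩
  exacts [segment_symm ℝ _ _, rfl]

lemma openSegment_src_tgt (o : ι × Bool) :
    openSegment ℝ (S.src o) (S.tgt o) = openSegment ℝ (S.a o.1) (S.b o.1) := by
  rcases o with ⟨i, _ | _⟩
  exacts [openSegment_symm ℝ _ _, rfl]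

lemma src_mem_segment (o : ι × Bool) : S.src o ∈ segment ℝ (S.a o.1) (S.b o.1) :=
  S.segment_src_tgt o ▸ left_mem_segment ℝ _ _

lemma add_mul_dir_mem (o : ι × Bool) {t : ℝ} (ht : t ∈ Ioo (0 : ℝ) 1) :
    S.src o + t * S.dir o ∈ openSegment ℝ (S.a o.1) (S.b o.1) := by
  rw [← openSegment_src_tgt, openSegment_eq_image']
  exact ⟨t, ht, rfl⟩

lemma midpoint_mem (i : ι) : midpoint ℝ (S.a i) (S.b i) ∈ openSegment ℝ (S.a i) (S.b i) :=
  ⟨1 / 2, 1 / 2, by norm_num, by norm_num, by norm_num, by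
    rw [midpoint_eq_smul_add, smul_add, invOf_eq_inv, one_div]⟩

lemma notMem_segment_of_mem_openSegment {i j : ι} (hij : i ≠ j) {z : ℂ}
    (hz : z ∈ openSegment ℝ (S.a i) (S.b i)) : z ∉ segment ℝ (S.a j) (S.b j) := by
  intro h
  rcases S.inter i j hij z (openSegment_subset_segment _ _ _ hz) h with rfl | rfl
  · exact S.ne i (left_mem_openSegment_iff.1 hz)
  · exact S.ne i (right_mem_openSegment_iff.1 hz)

lemma isClosed_biUnion_segment [Finite ι] (T : Set ι) :
    IsClosed (⋃ i ∈ T, segment ℝ (S.a i) (S.b i)) :=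
  T.toFinite.isClosed_biUnion fun _ _ => (isCompact_segment _ _).isClosed

lemma exists_src_eq_of_mem (o : ι × Bool) {i : ι} (h : S.src o ∈ segment ℝ (S.a i) (S.b i)) :
    ∃ o' : ι × Bool, o'.1 = i ∧ S.src o' = S.src o := by
  by_cases hi : i = o.1
  · exact ⟨o, hi.symm, rfl⟩
  · rcases S.inter i o.1 hi _ h (S.src_mem_segment o) with h | h
    exacts [⟨(i, true), rfl, h.symm⟩, ⟨(i, false), rfl, h.symm⟩]

lemma exists_ball_src [Finite ι] (o : ι × Bool) :
    ∃ ε > 0, ∀ x ∈ Metric.ball (S.src o) ε, x ∈ S.carrier →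
      ∃ o' : ι × Bool, S.src o' = S.src o ∧ x ∈ segment ℝ (S.src o') (S.tgt o') := by
  obtain ⟨ε, hε, hball⟩ := Metric.isOpen_iff.1
    (S.isClosed_biUnion_segment {i | S.src o ∉ segment ℝ (S.a i) (S.b i)}).isOpen_compl (S.src o)
    (by simp)
  refine ⟨ε, hε, fun x hx hxc => ?_⟩
  obtain ⟨i, hi⟩ := mem_iUnion.1 hxc
  have hsrc : S.src o ∈ segment ℝ (S.a i) (S.b i) := by
    by_contra hsrc
    exact hball hx (mem_biUnion hsrc hi)
  obtain ⟨o', rfl, ho'⟩ := S.exists_src_eq_of_mem o hsrc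
  exact ⟨o', ho', by rwa [S.segment_src_tgt]⟩

/-! ### One-sided values along a segment -/

lemma exists_strip_disjoint [Finite ι] (o : ι × Bool) {x y : ℂ}
    (hx : x ∈ openSegment ℝ (S.a o.1) (S.b o.1)) (hy : y ∈ openSegment ℝ (S.a o.1) (S.b o.1)) :
    ∃ η > 0, ∀ z ∈ segment ℝ x y, ∀ s ∈ Ioo (0 : ℝ) η,
      z + s * (Complex.I * S.dir o) ∉ S.carrier := by
  have hsub : segment ℝ x y ⊆ openSegment ℝ (S.a o.1) (S.b o.1) :=
    (convex_openSegment _ _).segment_subset hx hy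
  have hoff : segment ℝ x y ⊆ (⋃ j ∈ {j | o.1 ≠ j}, segment ℝ (S.a j) (S.b j))ᶜ := by
    intro z hz hzC
    obtain ⟨j, hj, hzj⟩ := mem_iUnion₂.1 hzC
    exact S.notMem_segment_of_mem_openSegment hj (hsub hz) hzj
  obtain ⟨δ, hδ, hthick⟩ := (isCompact_segment x y).exists_thickening_subset_open
    (S.isClosed_biUnion_segment _).isOpen_compl hoff
  have hv : 0 < ‖Complex.I * S.dir o‖ :=
    norm_pos_iff.2 (mul_ne_zero Complex.I_ne_zero (S.dir_ne_zero o))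
  refine ⟨δ / ‖Complex.I * S.dir o‖, div_pos hδ hv, fun z hz s hs hmem => ?_⟩
  obtain ⟨j, hj⟩ := mem_iUnion.1 hmem
  by_cases hij : o.1 = j
  · have hz' := openSegment_subset_segment _ _ _ (hsub hz)
    rw [← hij, ← S.segment_src_tgt] at hj
    rw [← S.segment_src_tgt] at hz'
    exact hs.1.ne' (eq_zero_of_add_mul_I_mem_segment (S.src_ne_tgt o) hz' hj)
  · refine hthick (Metric.mem_thickening_iff.2 ⟨z, hz, ?_⟩) (mem_biUnion hij hj)
    rw [dist_eq_norm, add_sub_cancel_left, norm_mul, Complex.norm_real,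
      Real.norm_of_nonneg hs.1.le]
    exact (lt_div_iff₀ hv).1 hs.2

variable {S} {f : ℂ → ℝ}

lemma exists_sideValue_of_mem_openSegment [Finite ι]
    (hf : ∀ x ∉ S.carrier, ∀ᶠ y in 𝓝 x, f y = f x) (o : ι × Bool) {x y : ℂ}
    (hx : x ∈ openSegment ℝ (S.a o.1) (S.b o.1)) (hy : y ∈ openSegment ℝ (S.a o.1) (S.b o.1)) :
    ∃ c, SideValue f x (Complex.I * S.dir o) c ∧ SideValue f y (Complex.I * S.dir o) c := by
  obtain ⟨η, hη, hstrip⟩ := S.exists_strip_disjoint o hx hy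
  have hconst {z : ℂ} (hz : z ∈ segment ℝ x y) {s : ℝ} (hs : s ∈ Ioo 0 η) :
      f (z + s * (Complex.I * S.dir o)) = f (x + (η / 2 : ℝ) * (Complex.I * S.dir o)) :=
    comp_eq_of_isPreconnected hf (φ := fun q : ℂ × ℝ => q.1 + q.2 * (Complex.I * S.dir o))
      (x := (z, s)) (y := (x, η / 2))
      ((convex_segment x y).prod (convex_Ioo 0 η)).isPreconnected (by fun_prop)
      (fun q hq => hstrip q.1 hq.1 q.2 hq.2) ⟨hz, hs⟩
      ⟨left_mem_segment _ _ _, half_pos hη, half_lt_self hη⟩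
  refine ⟨f (x + (η / 2 : ℝ) * (Complex.I * S.dir o)), ?_, ?_⟩ <;>
    filter_upwards [Ioo_mem_nhdsGT hη] with s hs
  exacts [hconst (left_mem_segment _ _ _) hs, hconst (right_mem_segment _ _ _) hs]

/-! ### The sector between consecutive segments -/

variable (S) in
lemma exists_sector_disjoint [Finite ι] {o₁ o₂ : ι × Bool} (h : S.IsNext o₁ o₂) :
    ∃ ε > 0, ∀ ρ ∈ Ioo (0 : ℝ) ε, ∀ β ∈ Ioo 0 (ccwAngle (S.dir o₁) (S.dir o₂)),
      S.src o₁ + ρ * Complex.exp (β * Complex.I) * S.dir o₁ ∉ S.carrier := by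
  obtain ⟨ε, hε, hball⟩ := S.exists_ball_src o₁
  have hnorm := norm_pos_iff.2 (S.dir_ne_zero o₁)
  refine ⟨ε / ‖S.dir o₁‖, div_pos hε hnorm, fun ρ hρ β hβ hmem => ?_⟩
  obtain ⟨o₃, ho₃, hx⟩ := hball _ (by
    rw [Metric.mem_ball, dist_eq_norm, add_sub_cancel_left, norm_mul, norm_mul,
      Complex.norm_real, Complex.norm_exp_ofReal_mul_I, mul_one, Real.norm_of_nonneg hρ.1.le]
    exact (lt_div_iff₀ hnorm).1 hρ.2) hmem
  rw [segment_eq_image'] at hx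
  obtain ⟨τ, hτ, hxτ⟩ := hx
  simp only [Complex.real_smul, ho₃, add_right_inj] at hxτ
  have hτ₀ : τ ≠ 0 := by
    rintro rfl
    have hne : (ρ : ℂ) * Complex.exp (β * Complex.I) * S.dir o₁ ≠ 0 :=
      mul_ne_zero (mul_ne_zero (by exact_mod_cast hρ.1.ne') (Complex.exp_ne_zero _))
        (S.dir_ne_zero o₁)
    exact hne (by simp [← hxτ])
  have hdir : S.dir o₃ = ((ρ / τ : ℝ) : ℂ) * Complex.exp (β * Complex.I) * S.dir o₁ := by
    have hτc : (τ : ℂ) ≠ 0 := by exact_mod_cast hτ₀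
    push_cast
    rw [dir, ho₃]
    field_simp
    linear_combination hxτ
  have hangle : ccwAngle (S.dir o₁) (S.dir o₃) = β :=
    ccwAngle_eq_of_eq_mul_exp (S.dir_ne_zero o₁) (div_pos hρ.1 (hτ.1.lt_of_ne' hτ₀)) hβ.1
      (hβ.2.le.trans (ccwAngle_le _ _)) hdir
  exact hβ.2.not_ge (hangle ▸ h.2 o₃ ho₃)

lemma eventually_add_mul_I_eq_mul_exp {t R α : ℝ} (ht : t ∈ Ioo 0 R) (hα : 0 < α) :
    ∀ᶠ s : ℝ in 𝓝[>] 0, ∃ ρ ∈ Ioo 0 R, ∃ β ∈ Ioo 0 α,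
      (t + s * Complex.I : ℂ) = ρ * Complex.exp (β * Complex.I) := by
  have hcont : ContinuousAt (fun s : ℝ => (t + s * Complex.I : ℂ)) 0 := by fun_prop
  have hnorm : ∀ᶠ s : ℝ in 𝓝 0, ‖(t + s * Complex.I : ℂ)‖ ∈ Ioo 0 R :=
    hcont.norm.eventually_mem (Ioo_mem_nhds (by simpa using ht.1.ne')
      (by simpa [abs_of_pos ht.1] using ht.2))
  have harg : ∀ᶠ s : ℝ in 𝓝 0, Complex.arg (t + s * Complex.I) < α :=
    (ContinuousAt.comp (g := Complex.arg) (Complex.continuousAt_arg (by simp [ht.1]))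
      hcont).eventually_lt_const (by simpa [Complex.arg_ofReal_of_nonneg ht.1.le] using hα)
  filter_upwards [hnorm.filter_mono inf_le_left, harg.filter_mono inf_le_left,
    self_mem_nhdsWithin] with s hs₁ hs₂ hs
  have hpos : 0 < Complex.arg (t + s * Complex.I) := by
    have him : 0 < (t + s * Complex.I : ℂ).im := by simpa using hs
    refine (Complex.arg_nonneg_iff.2 him.le).lt_of_ne' fun h₀ => ?_
    exact him.ne' (Complex.arg_eq_zero_iff.1 h₀).2
  exact ⟨_, hs₁, _, ⟨hpos, hs₂⟩, (Complex.norm_mul_exp_arg_mul_I _).symm⟩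

lemma eventually_sub_mul_I_eq_mul_exp {t R α : ℝ} (ht : t ∈ Ioo 0 R) (hα : 0 < α) :
    ∀ᶠ s : ℝ in 𝓝[>] 0, ∃ ρ ∈ Ioo 0 R, ∃ β ∈ Ioo 0 α,
      (t - s * Complex.I : ℂ) = ρ * Complex.exp (-β * Complex.I) := by
  filter_upwards [eventually_add_mul_I_eq_mul_exp ht hα] with s ⟨ρ, hρ, β, hβ, h⟩
  refine ⟨ρ, hρ, β, hβ, ?_⟩
  simpa [← Complex.exp_conj, sub_eq_add_neg] using congrArg (starRingEnd ℂ) h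

lemma exists_sideValue_of_isNext [Finite ι] (hf : ∀ x ∉ S.carrier, ∀ᶠ y in 𝓝 x, f y = f x)
    {o₁ o₂ : ι × Bool} (h : S.IsNext o₁ o₂) :
    ∃ c, ∃ δ > 0, ∀ t ∈ Ioo (0 : ℝ) δ,
      SideValue f (S.src o₁ + t * S.dir o₁) (Complex.I * S.dir o₁) c ∧
      SideValue f (S.src o₁ + t * S.dir o₂) (-(Complex.I * S.dir o₂)) c := by
  obtain ⟨ε, hε, hsector⟩ := S.exists_sector_disjoint h
  obtain ⟨r, hr, hdir⟩ := exists_eq_mul_exp_ccwAngle (S.dir_ne_zero o₁) (S.dir_ne_zero o₂)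
  have hα := ccwAngle_pos (S.dir o₁) (S.dir o₂)
  set α := ccwAngle (S.dir o₁) (S.dir o₂)
  let φ (q : ℝ × ℝ) : ℂ := S.src o₁ + q.1 * Complex.exp (q.2 * Complex.I) * S.dir o₁
  have hconst {ρ β : ℝ} (hρ : ρ ∈ Ioo 0 ε) (hβ : β ∈ Ioo 0 α) :
      f (φ (ρ, β)) = f (φ (ε / 2, α / 2)) :=
    comp_eq_of_isPreconnected hf (isPreconnected_Ioo.prod isPreconnected_Ioo)
      (by fun_prop) (fun q hq => hsector q.1 hq.1 q.2 hq.2) (mk_mem_prod hρ hβ)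
      (mk_mem_prod ⟨half_pos hε, half_lt_self hε⟩ ⟨half_pos hα, half_lt_self hα⟩)
  refine ⟨f (φ (ε / 2, α / 2)), min ε (ε / r), lt_min hε (div_pos hε hr), fun t ht => ⟨?_, ?_⟩⟩
  · filter_upwards [eventually_add_mul_I_eq_mul_exp ⟨ht.1, ht.2.trans_le (min_le_left _ _)⟩ hα]
      with s ⟨ρ, hρ, β, hβ, hpolar⟩
    rw [← hconst hρ hβ]
    congr 1
    linear_combination S.dir o₁ * hpolar
  · filter_upwards [eventually_sub_mul_I_eq_mul_exp ⟨ht.1, ht.2.trans_le (min_le_right _ _)⟩ hα]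
      with s ⟨ρ, hρ, β, hβ, hpolar⟩
    rw [← hconst (ρ := ρ * r) (β := α - β) ⟨mul_pos hρ.1 hr, (lt_div_iff₀ hr).1 hρ.2⟩
      ⟨by linarith [hβ.2], by linarith [hβ.1]⟩]
    congr 1
    simp only [φ]
    push_cast
    rw [hdir, sub_eq_add_neg, add_mul, Complex.exp_add]
    linear_combination (r * Complex.exp (α * Complex.I) * S.dir o₁) * hpolar

/-! ### Circulations as differences of face values -/

/-- `l o` is the value on the left of the oriented segment `o` of a function that jumps by `w i`
across the segment `i` and is constant in the sectors between consecutive segments. -/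
structure IsLeftValue (S : SegmentSystem ι) (w : ι → ℝ) (l : ι × Bool → ℝ) : Prop where
  sub_eq : ∀ i, l (i, true) - l (i, false) = w i
  eq_rev_of_isNext : ∀ {o₁ o₂}, S.IsNext o₁ o₂ → l o₁ = l (rev o₂)

lemma tendsto_potential_midpoint [Fintype ι] [DecidableEq ι] (w : ι → ℝ) (i : ι) {v : ℂ} {θ : ℝ}
    (hθ : Tendsto (fun s : ℝ => subtendedAngle (S.a i) (S.b i)
      (midpoint ℝ (S.a i) (S.b i) + s * v)) (𝓝[>] 0) (𝓝 θ)) :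
    Tendsto (fun s : ℝ => S.potential w (midpoint ℝ (S.a i) (S.b i) + s * v)) (𝓝[>] 0)
      (𝓝 (w i * (θ / (2 * π)) + ∑ j ∈ Finset.univ.erase i,
        w j * (subtendedAngle (S.a j) (S.b j) (midpoint ℝ (S.a i) (S.b i)) / (2 * π)))) := by
  set m := midpoint ℝ (S.a i) (S.b i)
  simp only [potential, ← Finset.add_sum_erase _ _ (Finset.mem_univ i)]
  refine ((hθ.div_const _).const_mul _).add (tendsto_finsetSum _ fun j hj => ?_)
  have hmid : Tendsto (fun s : ℝ => m + s * v) (𝓝[>] 0) (𝓝 m) := by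
    have hcont : Continuous fun s : ℝ => m + s * v := by fun_prop
    simpa using (hcont.tendsto 0).mono_left nhdsWithin_le_nhds
  have hangle : ContinuousAt (subtendedAngle (S.a j) (S.b j)) m := continuousAt_subtendedAngle
    (S.notMem_segment_of_mem_openSegment (Finset.ne_of_mem_erase hj).symm (S.midpoint_mem i))
  exact ((hangle.tendsto.comp hmid).div_const _).const_mul _

lemma exists_isLeftValue [Fintype ι] {w : ι → ℝ} (hw : IsCirculation S.a S.b w) :
    ∃ l, S.IsLeftValue w l := by
  classical
  have hf (x : ℂ) (hx : x ∉ S.carrier) := S.eventually_potential_eq hw hx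
  have hside (o : ι × Bool) : ∃ c, ∀ x ∈ openSegment ℝ (S.a o.1) (S.b o.1),
      SideValue (S.potential w) x (Complex.I * S.dir o) c := by
    obtain ⟨c, hc, -⟩ := exists_sideValue_of_mem_openSegment hf o (S.midpoint_mem _)
      (S.midpoint_mem _)
    refine ⟨c, fun x hx => ?_⟩
    obtain ⟨d, hd, hd'⟩ := exists_sideValue_of_mem_openSegment hf o (S.midpoint_mem _) hx
    rwa [hc.unique hd]
  choose l hl using hside
  refine ⟨l, fun i => ?_, fun {o₁ o₂} h => ?_⟩
  · have hleft := (hl (i, true) _ (S.midpoint_mem i)).eq_of_tendsto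
      (tendsto_potential_midpoint w i (tendsto_subtendedAngle_left (S.ne i)))
    have hright : SideValue (S.potential w) _ _ (l (i, false)) :=
      hl (rev (i, true)) _ (S.midpoint_mem i)
    rw [S.dir_rev, mul_neg] at hright
    rw [hleft, hright.eq_of_tendsto
      (tendsto_potential_midpoint w i (tendsto_subtendedAngle_right (S.ne i)))]
    field_simp
    ring
  · obtain ⟨c, δ, hδ, hsector⟩ := exists_sideValue_of_isNext hf h
    obtain ⟨t, ht₀, ht⟩ := exists_between (lt_min hδ one_pos)
    obtain ⟨hc₁, hc₂⟩ := hsector t ⟨ht₀, ht.trans_le (min_le_left _ _)⟩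
    have ht₁ : t ∈ Ioo (0 : ℝ) 1 := ⟨ht₀, ht.trans_le (min_le_right _ _)⟩
    have hrev := hl (rev o₂) _ (S.add_mul_dir_mem o₂ ht₁)
    rw [S.dir_rev, mul_neg, h.1] at hrev
    exact ((hl o₁ _ (S.add_mul_dir_mem o₁ ht₁)).unique hc₁).trans (hrev.unique hc₂).symm

end SegmentSystem

/-! ### Rotations -/

lemma apply_eq_of_sameCycle {α β : Type*} {σ : Equiv.Perm α} {f : α → β}
    (hf : ∀ x, f (σ x) = f x) {x y : α} (h : σ.SameCycle x y) : f x = f y := by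
  obtain ⟨k, rfl⟩ := h
  induction k with
  | zero => rfl
  | succ k ih => rw [ih, add_comm, zpow_add, zpow_one, Equiv.Perm.mul_apply, hf]
  | pred k ih =>
    rw [ih, ← hf ((σ ^ (-(k : ℤ) - 1)) x), ← Equiv.Perm.mul_apply, ← zpow_one_add,
      add_sub_cancel]

section Rotation

variable {D V : Type*} {f : D → V} {u : D → ℂ}

lemma ccwAngle_comm {u v : ℂ} (hu : u ≠ 0) (hv : v ≠ 0) (h : ccwAngle u v < 2 * π) :
    ccwAngle v u = 2 * π - ccwAngle u v := by
  have hself := ccwAngle_self hu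
  rcases le_or_gt (ccwAngle u v + ccwAngle v u) (2 * π) with hsum | hsum
  · linarith [ccwAngle_add hu hv hu hsum]
  · linarith [ccwAngle_add_sub hu hv hu hsum, ccwAngle_le v u]

lemma injective_of_isNextCCW (hu : ∀ d, u d ≠ 0)
    (hne : ∀ d d', d ≠ d' → f d = f d' → ccwAngle (u d) (u d') < 2 * π) {s : D → D}
    (hs : ∀ d, IsNextCCW f u d (s d)) : Function.Injective s := by
  intro d e hde
  by_contra hde'
  have hf : f d = f e := by rw [← (hs d).1, hde, (hs e).1]
  have hcomm := ccwAngle_comm (hu d) (hu e) (hne d e hde' hf)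
  have hd := (hs d).2 e hf.symm
  have he := (hs e).2 d hf
  rw [← hde] at he
  linarith [ccwAngle_add (hu d) (hu e) (hu (s d)) (by linarith), ccwAngle_pos (u e) (u (s d))]

-- If `e` in the orbit of `d` minimises the angle from `e` to `d'`, then turning on to `σ e` cannot
-- pass `d'`, so it would decrease that angle.
lemma sameCycle_of_isNextCCW [Finite D] (hu : ∀ d, u d ≠ 0)
    (hne : ∀ d d', d ≠ d' → f d = f d' → ccwAngle (u d) (u d') < 2 * π) {σ : Equiv.Perm D}
    (hσ : ∀ d, IsNextCCW f u d (σ d)) {d d' : D} (hf : f d = f d') : σ.SameCycle d d' := by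
  obtain ⟨e, he : σ.SameCycle d e, hmin⟩ := {e | σ.SameCycle d e}.toFinite.exists_minimalFor
    (fun e => ccwAngle (u e) (u d')) _ ⟨d, Equiv.Perm.SameCycle.refl σ d⟩
  have he' : σ.SameCycle d (σ e) := Equiv.Perm.sameCycle_apply_right.2 he
  by_contra hd'
  have hfe : f d' = f (σ e) :=
    hf.symm.trans (apply_eq_of_sameCycle (fun x => (hσ x).1) he')
  have hlt : ccwAngle (u (σ e)) (u d') < 2 * π :=
    hne _ _ (fun h => hd' (h ▸ he')) hfe.symm
  have hnext := (hσ e).2 d' (hfe.trans (hσ e).1)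
  rcases le_or_gt (ccwAngle (u e) (u (σ e)) + ccwAngle (u (σ e)) (u d')) (2 * π) with h | h
  · have hadd := ccwAngle_add (hu e) (hu (σ e)) (hu d') h
    have hpos := ccwAngle_pos (u e) (u (σ e))
    linarith [hmin he' (by linarith)]
  · linarith [ccwAngle_add_sub (hu e) (hu (σ e)) (hu d') h]

lemma exists_perm_isNextCCW [Finite D] (hu : ∀ d, u d ≠ 0)
    (hne : ∀ d d', d ≠ d' → f d = f d' → ccwAngle (u d) (u d') < 2 * π) :
    ∃ σ : Equiv.Perm D, ∀ d, IsNextCCW f u d (σ d) := by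
  have hex (d : D) : ∃ e, IsNextCCW f u d e := by
    obtain ⟨e, he, hmin⟩ := exists_min_image {e | f e = f d} (fun e => ccwAngle (u d) (u e))
      (toFinite _) ⟨d, rfl⟩
    exact ⟨e, he, hmin⟩
  choose s hs using hex
  exact ⟨Equiv.ofBijective s (injective_of_isNextCCW hu hne hs).bijective_of_finite, hs⟩

end Rotation

lemma SegmentSystem.ccwAngle_lt {ι : Type*} (S : SegmentSystem ι) {o₁ o₂ : ι × Bool}
    (hne : o₁.1 ≠ o₂.1) (hsrc : S.src o₁ = S.src o₂) :
    ccwAngle (S.dir o₁) (S.dir o₂) < 2 * π := by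
  refine (ccwAngle_le _ _).lt_of_ne fun h => ?_
  obtain ⟨r, hr, hdir⟩ := exists_eq_mul_exp_ccwAngle (S.dir_ne_zero o₁) (S.dir_ne_zero o₂)
  rw [h, Complex.ofReal_mul, Complex.ofReal_ofNat, Complex.exp_two_pi_mul_I, mul_one] at hdir
  obtain ⟨t, ht₀, ht⟩ := exists_between (lt_min one_pos (inv_pos.2 hr))
  have h₁ := S.add_mul_dir_mem o₁ (t := r * t)
    ⟨mul_pos hr ht₀, by simpa [hr.ne'] using mul_lt_mul_of_pos_left (lt_min_iff.1 ht).2 hr⟩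
  have h₂ := S.add_mul_dir_mem o₂ ⟨ht₀, ht.trans_le (min_le_left _ _)⟩
  refine S.notMem_segment_of_mem_openSegment hne h₁ ?_
  convert openSegment_subset_segment _ _ _ h₂ using 1
  rw [hsrc, hdir]
  push_cast
  ring

/-! ### The dimension count behind Euler's formula -/

section Gradient

variable {V E F : Type*}

/-- The differences of a function on vertices along the edges, each directed from its `tail` to its
`head`; with values in a Euclidean space, where the circulations are the orthogonal complement of
the gradients. -/
noncomputable def discreteGradient (tail head : E → V) : (V → ℝ) →ₗ[ℝ] EuclideanSpace ℝ E :=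
  (WithLp.linearEquiv 2 ℝ (E → ℝ)).symm ∘ₗ (LinearMap.funLeft ℝ ℝ head - LinearMap.funLeft ℝ ℝ tail)

@[simp]
lemma discreteGradient_apply (tail head : E → V) (g : V → ℝ) (e : E) :
    discreteGradient tail head g e = g (head e) - g (tail e) := rfl

lemma mem_orthogonal_range_discreteGradient [Fintype E] {tail head : E → V}
    {z : EuclideanSpace ℝ E} :
    z ∈ (LinearMap.range (discreteGradient tail head))ᗮ ↔ IsCirculation tail head z := by
  simp [Submodule.mem_orthogonal, PiLp.inner_apply, IsCirculation]

lemma finrank_range_discreteGradient_add_one_le [Finite V] [Nonempty V] (tail head : E → V) :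
    Module.finrank ℝ (LinearMap.range (discreteGradient tail head)) + 1 ≤ Nat.card V := by
  have := Fintype.ofFinite V
  have hconst : (fun _ => 1 : V → ℝ) ∈ LinearMap.ker (discreteGradient tail head) := by
    ext e
    simp
  have hker : 0 < Module.finrank ℝ (LinearMap.ker (discreteGradient tail head)) :=
    Module.finrank_pos_iff_exists_ne_zero.2 ⟨⟨_, hconst⟩, fun h₀ =>
      one_ne_zero (congrFun (congrArg Subtype.val h₀) (Classical.arbitrary V))⟩
  have hsum := (discreteGradient tail head).finrank_range_add_finrank_ker
  rw [Module.finrank_fintype_fun_eq_card, ← Nat.card_eq_fintype_card] at hsum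
  omega

lemma card_add_two_le_of_circulation [Finite V] [Fintype E] [Finite F] [Nonempty V] [Nonempty F]
    (tail head : E → V) (left right : E → F)
    (h : ∀ z : E → ℝ, IsCirculation tail head z →
      ∃ p : F → ℝ, ∀ e, p (left e) - p (right e) = z e) :
    Nat.card E + 2 ≤ Nat.card V + Nat.card F := by
  have hle : (LinearMap.range (discreteGradient tail head))ᗮ ≤
      LinearMap.range (discreteGradient right left) := by
    intro z hz
    obtain ⟨p, hp⟩ := h z (mem_orthogonal_range_discreteGradient.1 hz)
    exact ⟨p, PiLp.ext hp⟩
  have hdim := (LinearMap.range (discreteGradient tail head)).finrank_add_finrank_orthogonal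
  rw [finrank_euclideanSpace, ← Nat.card_eq_fintype_card] at hdim
  have hface := Submodule.finrank_mono hle
  have hV := finrank_range_discreteGradient_add_one_le tail head
  have hF := finrank_range_discreteGradient_add_one_le right left
  omega

end Gradient

/-! ### Polygonal drawings in the complex plane -/

/-- The first `n` segments of the polygonal path with corners `q 0, q 1, …` do not meet except
for common corners of consecutive ones. -/
structure IsSimplePath {E : Type*} [AddCommGroup E] [Module ℝ E] (n : ℕ) (q : ℕ → E) :
    Prop where
  ne : ∀ i, i < n → q i ≠ q (i + 1)
  inter_succ : ∀ i, i + 1 < n →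
    segment ℝ (q i) (q (i + 1)) ∩ segment ℝ (q (i + 1)) (q (i + 2)) = {q (i + 1)}
  disjoint : ∀ i j, i + 1 < j → j < n →
    Disjoint (segment ℝ (q i) (q (i + 1))) (segment ℝ (q j) (q (j + 1)))

namespace IsSimplePath

variable {E : Type*} [AddCommGroup E] [Module ℝ E] {n : ℕ} {q : ℕ → E}

lemma map {F : Type*} [AddCommGroup F] [Module ℝ F] (h : IsSimplePath n q) {φ : E →ₗ[ℝ] F}
    (hφ : Function.Injective φ) : IsSimplePath n (φ ∘ q) where
  ne i hi := hφ.ne (h.ne i hi)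
  inter_succ i hi := by
    have himage (x y : E) := image_segment ℝ φ.toAffineMap x y
    simp only [LinearMap.coe_toAffineMap] at himage
    simp only [Function.comp_apply, ← himage, ← image_inter hφ, h.inter_succ i hi,
      image_singleton]
  disjoint i j hij hj := by
    have himage (x y : E) := image_segment ℝ φ.toAffineMap x y
    simp only [LinearMap.coe_toAffineMap] at himage
    simpa only [Function.comp_apply, ← himage, disjoint_image_iff hφ] using h.disjoint i j hij hj

lemma eq_of_mem_of_mem (h : IsSimplePath n q) {i j : ℕ} (hij : i < j) (hj : j < n) {z : E}
    (hzi : z ∈ segment ℝ (q i) (q (i + 1))) (hzj : z ∈ segment ℝ (q j) (q (j + 1))) :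
    j = i + 1 ∧ z = q (i + 1) := by
  have hji : j = i + 1 := by
    by_contra hne
    exact disjoint_left.1 (h.disjoint i j (by lia) hj) hzi hzj
  subst hji
  have hz : z ∈ ({q (i + 1)} : Set E) := h.inter_succ i hj ▸ ⟨hzi, hzj⟩
  exact ⟨rfl, hz⟩

lemma eq_endpoint_of_mem (h : IsSimplePath n q) {i j : ℕ} (hi : i < n) (hj : j < n)
    (hij : i ≠ j) {z : E} (hzi : z ∈ segment ℝ (q i) (q (i + 1)))
    (hzj : z ∈ segment ℝ (q j) (q (j + 1))) : z = q i ∨ z = q (i + 1) := by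
  rcases hij.lt_or_gt with hlt | hgt
  · exact Or.inr (h.eq_of_mem_of_mem hlt hj hzi hzj).2
  · obtain ⟨rfl, hz⟩ := h.eq_of_mem_of_mem hgt hi hzj hzi
    exact Or.inl hz

lemma eq_or_eq_of_mem (h : IsSimplePath n q) {k i : ℕ} (hk : k ≤ n) (hi : i < n)
    (hmem : q k ∈ segment ℝ (q i) (q (i + 1))) : k = i ∨ k = i + 1 := by
  by_contra! hcon
  rcases hcon.1.lt_or_gt with hlt | hgt
  · obtain ⟨-, hki⟩ := h.eq_of_mem_of_mem hlt hi (left_mem_segment _ _ _) hmem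
    exact h.ne k (hlt.trans hi) hki
  · obtain ⟨m, rfl⟩ : ∃ m, k = m + 1 := ⟨k - 1, by lia⟩
    obtain ⟨rfl, hmi⟩ := h.eq_of_mem_of_mem (by lia : i < m) hk hmem (right_mem_segment _ _ _)
    exact h.ne (i + 1) hk hmi.symm

lemma injOn (h : IsSimplePath n q) : InjOn q (Iic n) := by
  intro k hk i hi heq
  rw [mem_Iic] at hk hi
  wlog hki : k < i generalizing k i
  · exact (not_lt.1 hki).eq_or_lt.elim Eq.symm fun hlt => (this hi hk heq.symm hlt).symm
  rcases h.eq_or_eq_of_mem hi (hki.trans_le hi) (heq ▸ left_mem_segment _ _ _) with hik | hik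
  · exact hik.symm
  · exact absurd (hik ▸ heq) (h.ne k (hki.trans_le hi))

end IsSimplePath

/-- A drawing of `G` in the complex plane in which every edge `e` comes with an orientation and
with the corners of a polygonal path of `length e` segments that draws it. -/
structure PolygonalDrawing {V : Type*} (G : SimpleGraph V) where
  point : V → ℂ
  point_injective : Function.Injective point
  tail : G.edgeSet → V
  head : G.edgeSet → V
  eq_mk : ∀ e : G.edgeSet, (e : Sym2 V) = s(tail e, head e)
  length : G.edgeSet → ℕ
  length_pos : ∀ e, 0 < length e
  corner : G.edgeSet → ℕ → ℂ
  corner_zero : ∀ e, corner e 0 = point (tail e)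
  corner_length : ∀ e, corner e (length e) = point (head e)
  isSimplePath : ∀ e, IsSimplePath (length e) (corner e)
  mem_of_point_mem : ∀ (e : G.edgeSet) i v, i < length e →
    point v ∈ segment ℝ (corner e i) (corner e (i + 1)) → v ∈ (e : Sym2 V)
  exists_of_mem_of_mem : ∀ e f : G.edgeSet, e ≠ f → ∀ i j, i < length e → j < length f →
    ∀ z ∈ segment ℝ (corner e i) (corner e (i + 1)),
      z ∈ segment ℝ (corner f j) (corner f (j + 1)) → ∃ v, v ∈ (e : Sym2 V) ∧ point v = z

section Drawing

variable {V : Type*} {G : SimpleGraph V}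

lemma nonempty_polygonalDrawing (h : G.IsPlanar) : Nonempty (PolygonalDrawing G) := by
  obtain ⟨D⟩ := h
  have hex (e : G.edgeSet) : ∃ t h : V, (e : Sym2 V) = s(t, h) ∧
      SimpleGraph.IsPolygonalArc (D.arc e) (D.point t) (D.point h) := by
    rcases e with ⟨⟨t, h⟩, he⟩
    exact ⟨t, h, rfl, D.isPolygonalArc_arc t h he⟩
  choose t h heq n p hn hp₀ hpn harc hne hsucc hdisj using hex
  let φ : (ℝ × ℝ) ≃ₗ[ℝ] ℂ := Complex.equivRealProdLm.symm
  have himage (x y : ℝ × ℝ) : segment ℝ (φ x) (φ y) = φ '' segment ℝ x y :=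
    (image_segment ℝ φ.toLinearMap.toAffineMap x y).symm
  have hmem {e i z} (hi : i < n e) (hz : z ∈ segment ℝ (p e i) (p e (i + 1))) : z ∈ D.arc e :=
    harc e ▸ mem_iUnion.2 ⟨⟨i, hi⟩, hz⟩
  exact ⟨{
    point v := φ (D.point v)
    point_injective := φ.injective.comp D.point_injective
    tail := t
    head := h
    eq_mk := heq
    length := n
    length_pos := hn
    corner e i := φ (p e i)
    corner_zero e := by rw [hp₀]
    corner_length e := by rw [hpn]
    isSimplePath e := IsSimplePath.map (φ := φ.toLinearMap) ⟨hne e, hsucc e, hdisj e⟩ φ.injective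
    mem_of_point_mem e i v hi hv := by
      rw [himage, φ.injective.mem_set_image] at hv
      exact D.mem_of_point_mem_arc e e.2 v (hmem hi hv)
    exists_of_mem_of_mem e f hef i j hi hj := by
      simp only [himage, forall_mem_image, φ.injective.mem_set_image, φ.injective.eq_iff]
      intro z hz hz'
      obtain ⟨v, hv, -, hvz⟩ := D.exists_of_mem_arc_inter e e.2 f f.2
        (Subtype.coe_injective.ne hef) z ⟨hmem hi hz, hmem hj hz'⟩
      exact ⟨v, hv, hvz⟩ }⟩

end Drawing

namespace PolygonalDrawing

variable {V : Type*} {G : SimpleGraph V} (P : PolygonalDrawing G)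

lemma exists_eq_corner {e : G.edgeSet} {v : V} (hv : v ∈ (e : Sym2 V)) :
    ∃ k, (k = 0 ∨ k = P.length e) ∧ P.corner e k = P.point v := by
  rw [P.eq_mk, Sym2.mem_iff] at hv
  rcases hv with rfl | rfl
  exacts [⟨0, Or.inl rfl, P.corner_zero e⟩, ⟨P.length e, Or.inr rfl, P.corner_length e⟩]

lemma eq_corner_of_point_mem {e : G.edgeSet} {i : ℕ} {v : V} (hi : i < P.length e)
    (hv : P.point v ∈ segment ℝ (P.corner e i) (P.corner e (i + 1))) :
    P.point v = P.corner e i ∨ P.point v = P.corner e (i + 1) := by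
  obtain ⟨k, hk, hkv⟩ := P.exists_eq_corner (P.mem_of_point_mem e i v hi hv)
  rw [← hkv] at hv ⊢
  exact ((P.isSimplePath e).eq_or_eq_of_mem (by lia) hi hv).imp (congrArg _) (congrArg _)

/-- The segments of a polygonal drawing, oriented along the chosen orientations of the edges. -/
def segmentSystem : SegmentSystem (Σ e : G.edgeSet, Fin (P.length e)) where
  a i := P.corner i.1 i.2
  b i := P.corner i.1 (i.2 + 1)
  ne i := (P.isSimplePath i.1).ne i.2 i.2.2
  inter := by
    rintro ⟨e, i⟩ ⟨f, j⟩ hij z hz hz'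
    by_cases hef : e = f
    · subst hef
      exact (P.isSimplePath e).eq_endpoint_of_mem i.2 j.2 (fun h => hij (by rw [Fin.ext h]))
        hz hz'
    · obtain ⟨v, -, rfl⟩ := P.exists_of_mem_of_mem e f hef i j i.2 j.2 z hz hz'
      exact P.eq_corner_of_point_mem i.2 hz

/-- The dart along the chosen orientation of an edge. -/
def forward (e : G.edgeSet) : G.Dart :=
  ⟨(P.tail e, P.head e), by rw [← SimpleGraph.mem_edgeSet, ← P.eq_mk]; exact e.2⟩

lemma edge_forward (e : G.edgeSet) : (P.forward e).edge = e := (P.eq_mk e).symm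

lemma exists_eq_forward (d : G.Dart) : ∃ e, d = P.forward e ∨ d = (P.forward e).symm :=
  ⟨⟨d.edge, d.edge_mem⟩, (SimpleGraph.dart_edge_eq_iff _ _).1 (P.edge_forward ⟨_, _⟩).symm⟩

open Classical in
/-- The first segment on the path along a dart, oriented away from the source of the dart. -/
noncomputable def first (d : G.Dart) : (Σ e : G.edgeSet, Fin (P.length e)) × Bool :=
  let e : G.edgeSet := ⟨d.edge, d.edge_mem⟩
  if d = P.forward e then (⟨e, 0, P.length_pos e⟩, true)
  else (⟨e, P.length e - 1, Nat.sub_lt (P.length_pos e) one_pos⟩, false)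

lemma first_fst (d : G.Dart) : (P.first d).1.1 = (⟨d.edge, d.edge_mem⟩ : G.edgeSet) := by
  rw [first]
  split_ifs <;> rfl

open Classical in
lemma first_of_edge_eq {d : G.Dart} {e : G.edgeSet} (he : d.edge = e) :
    P.first d = if d = P.forward e then (⟨e, 0, P.length_pos e⟩, true)
      else (⟨e, P.length e - 1, Nat.sub_lt (P.length_pos e) one_pos⟩, false) := by
  obtain rfl : e = ⟨d.edge, d.edge_mem⟩ := Subtype.ext he.symm
  rfl

lemma first_forward (e : G.edgeSet) :
    P.first (P.forward e) = (⟨e, 0, P.length_pos e⟩, true) := by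
  rw [P.first_of_edge_eq (P.edge_forward e), if_pos rfl]

lemma first_forward_symm (e : G.edgeSet) : P.first (P.forward e).symm =
    (⟨e, P.length e - 1, Nat.sub_lt (P.length_pos e) one_pos⟩, false) := by
  rw [P.first_of_edge_eq ((P.forward e).edge_symm.trans (P.edge_forward e)),
    if_neg (P.forward e).symm_ne]

lemma src_first (d : G.Dart) : P.segmentSystem.src (P.first d) = P.point d.fst := by
  obtain ⟨e, rfl | rfl⟩ := P.exists_eq_forward d
  · rw [first_forward]
    exact P.corner_zero e
  · rw [first_forward_symm]
    change P.corner e (P.length e - 1 + 1) = _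
    rw [Nat.sub_add_cancel (P.length_pos e)]
    exact P.corner_length e

lemma exists_first_eq {o : (Σ e : G.edgeSet, Fin (P.length e)) × Bool} {v : V}
    (h : P.segmentSystem.src o = P.point v) : ∃ d : G.Dart, d.fst = v ∧ P.first d = o := by
  have hv := P.segmentSystem.src_mem_segment o
  rw [h] at hv
  rcases o with ⟨⟨e, i, hi⟩, b⟩
  obtain ⟨k, hk, hkv⟩ := P.exists_eq_corner (P.mem_of_point_mem e i v hi hv)
  cases b
  · have hik : i + 1 = k := (P.isSimplePath e).injOn hi (by simp; lia) (h.trans hkv.symm)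
    have hfirst : P.first (P.forward e).symm = (⟨e, i, hi⟩, false) := by
      obtain rfl : i = P.length e - 1 := by lia
      exact P.first_forward_symm e
    refine ⟨(P.forward e).symm, P.point_injective ?_, hfirst⟩
    rw [← P.src_first, hfirst, h]
  · have hik : i = k := (P.isSimplePath e).injOn hi.le (by simp; lia) (h.trans hkv.symm)
    have hfirst : P.first (P.forward e) = (⟨e, i, hi⟩, true) := by
      obtain rfl : i = 0 := by lia
      exact P.first_forward e
    refine ⟨P.forward e, P.point_injective ?_, hfirst⟩
    rw [← P.src_first, hfirst, h]

lemma ccwAngle_first_lt {d d' : G.Dart} (hne : d ≠ d') (h : d.fst = d'.fst) :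
    ccwAngle (P.segmentSystem.dir (P.first d)) (P.segmentSystem.dir (P.first d')) <
      2 * π := by
  refine P.segmentSystem.ccwAngle_lt (fun he => ?_) (by rw [src_first, src_first, h])
  have hedge : d.edge = d'.edge := by
    simpa only [first_fst, Subtype.mk.injEq] using congrArg Sigma.fst he
  rcases (SimpleGraph.dart_edge_eq_iff _ _).1 hedge with rfl | rfl
  exacts [hne rfl, d'.snd_ne_fst h]

lemma eq_of_src_eq_corner {e : G.edgeSet} {i : ℕ} (hi : i + 1 < P.length e)
    {o : (Σ e : G.edgeSet, Fin (P.length e)) × Bool}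
    (ho : P.segmentSystem.src o = P.corner e (i + 1)) :
    o = (⟨e, i, i.lt_succ_self.trans hi⟩, false) ∨ o = (⟨e, i + 1, hi⟩, true) := by
  have hmem := P.segmentSystem.src_mem_segment o
  rcases o with ⟨⟨f, j, hj⟩, b⟩
  by_cases hef : e = f
  · subst hef
    cases b with
    | false =>
      obtain rfl : j = i := Nat.succ_injective ((P.isSimplePath e).injOn hj hi.le ho)
      exact Or.inl rfl
    | true =>
      obtain rfl : j = i + 1 := (P.isSimplePath e).injOn hj.le hi.le ho
      exact Or.inr rfl
  · rw [ho] at hmem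
    obtain ⟨v, hv, hvz⟩ := P.exists_of_mem_of_mem e f hef i j (i.lt_succ_self.trans hi) hj _
      (right_mem_segment _ _ _) hmem
    obtain ⟨k, hk, hkv⟩ := P.exists_eq_corner hv
    have hki : k = i + 1 := (P.isSimplePath e).injOn (by simp; lia) hi.le (hkv.trans hvz)
    lia

section LeftValue

variable {P} {w : (Σ e : G.edgeSet, Fin (P.length e)) → ℝ}
  {l : (Σ e : G.edgeSet, Fin (P.length e)) × Bool → ℝ}

lemma leftValue_succ (hl : P.segmentSystem.IsLeftValue w l) {e : G.edgeSet} {i : ℕ}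
    (hi : i + 1 < P.length e) (b : Bool) :
    l (⟨e, i + 1, hi⟩, b) = l (⟨e, i, i.lt_succ_self.trans hi⟩, b) := by
  have hself (o o') : ccwAngle (P.segmentSystem.dir o) (P.segmentSystem.dir o') ≤
      ccwAngle (P.segmentSystem.dir o) (P.segmentSystem.dir o) := by
    rw [ccwAngle_self (P.segmentSystem.dir_ne_zero o)]
    exact ccwAngle_le _ _
  cases b with
  | true =>
    refine hl.eq_rev_of_isNext (o₁ := (_, true)) (o₂ := (_, false)) ⟨rfl, fun o ho => ?_⟩
    rcases P.eq_of_src_eq_corner hi ho with rfl | rfl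
    exacts [le_rfl, hself _ _]
  | false =>
    refine (hl.eq_rev_of_isNext (o₁ := (_, false)) (o₂ := (_, true)) ⟨rfl, fun o ho => ?_⟩).symm
    rcases P.eq_of_src_eq_corner hi ho with rfl | rfl
    exacts [hself _ _, le_rfl]

lemma leftValue_eq_zero (hl : P.segmentSystem.IsLeftValue w l) {e : G.edgeSet} {i : ℕ}
    (hi : i < P.length e) (b : Bool) : l (⟨e, i, hi⟩, b) = l (⟨e, 0, P.length_pos e⟩, b) := by
  induction i with
  | zero => rfl
  | succ i ih => exact (leftValue_succ hl hi b).trans (ih _)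

lemma leftValue_rev_first (hl : P.segmentSystem.IsLeftValue w l) (d : G.Dart) :
    l (SegmentSystem.rev (P.first d)) = l (P.first d.symm) := by
  obtain ⟨e, rfl | rfl⟩ := P.exists_eq_forward d
  · rw [first_forward, first_forward_symm]
    exact (leftValue_eq_zero hl _ _).symm
  · rw [SimpleGraph.Dart.symm_symm, first_forward, first_forward_symm]
    exact leftValue_eq_zero hl _ _

end LeftValue

lemma isCirculation_segmentSystem [Fintype G.edgeSet] {z : G.edgeSet → ℝ}
    (hz : IsCirculation P.tail P.head z) :
    IsCirculation P.segmentSystem.a P.segmentSystem.b fun i => z i.1 := by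
  intro g
  rw [Fintype.sum_sigma, ← hz fun v => g (P.point v)]
  refine Finset.sum_congr rfl fun e _ => ?_
  rw [← P.corner_length, ← P.corner_zero, ← Finset.sum_range_sub (fun i => g (P.corner e i)),
    ← Fin.sum_univ_eq_sum_range fun i => g (P.corner e (i + 1)) - g (P.corner e i),
    Finset.mul_sum]
  rfl

end PolygonalDrawing

/-! ### Rotation systems and Euler's inequality -/

section Rotation

variable {V : Type*} {G : SimpleGraph V}

/-- A rotation system: a permutation of the darts of `G` which, at every vertex, permutes the
darts issuing from it cyclically. -/
def IsRotationSystem (σ : Equiv.Perm G.Dart) : Prop :=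
  ∀ d d' : G.Dart, σ.SameCycle d d' ↔ d.fst = d'.fst

/-- The permutation whose cycles are the facial walks of the rotation system `σ`; if `σ` turns
counterclockwise, the face is on the right of its darts. -/
def facePerm (σ : Equiv.Perm G.Dart) : Equiv.Perm G.Dart :=
  (Function.Involutive.toPerm _ SimpleGraph.Dart.symm_involutive).trans σ

lemma facePerm_apply (σ : Equiv.Perm G.Dart) (d : G.Dart) : facePerm σ d = σ d.symm := rfl

/-- The faces of the rotation system `σ`. -/
abbrev Face (σ : Equiv.Perm G.Dart) : Type _ :=
  Quotient (Equiv.Perm.SameCycle.setoid (facePerm σ))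

lemma PolygonalDrawing.exists_faceValue [Finite V] (P : PolygonalDrawing G)
    {σ : Equiv.Perm G.Dart} [Fintype G.edgeSet]
    (hσ : ∀ d, P.segmentSystem.IsNext (P.first d) (P.first (σ d))) {z : G.edgeSet → ℝ}
    (hz : IsCirculation P.tail P.head z) :
    ∃ p : Face σ → ℝ, ∀ e, p ⟦(P.forward e).symm⟧ - p ⟦P.forward e⟧ = z e := by
  obtain ⟨l, hl⟩ := SegmentSystem.exists_isLeftValue (P.isCirculation_segmentSystem hz)
  have hinv (d : G.Dart) : l (P.first (facePerm σ d).symm) = l (P.first d.symm) := by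
    rw [← P.leftValue_rev_first hl, facePerm_apply, hl.eq_rev_of_isNext (hσ d.symm)]
  refine ⟨Quotient.lift (fun d : G.Dart => l (P.first d.symm))
    fun _ _ => apply_eq_of_sameCycle (f := fun d : G.Dart => l (P.first d.symm)) hinv, fun e => ?_⟩
  simp only [Quotient.lift_mk, SimpleGraph.Dart.symm_symm]
  rw [← P.leftValue_rev_first hl, P.first_forward]
  exact hl.sub_eq _

lemma exists_isRotationSystem [Finite V] (h : G.IsPlanar) :
    ∃ σ : Equiv.Perm G.Dart, IsRotationSystem σ ∧
      (Nonempty G.edgeSet →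
        Nat.card G.edgeSet + 2 ≤ Nat.card V + Nat.card (Face σ)) := by
  classical
  have := Fintype.ofFinite V
  obtain ⟨P⟩ := nonempty_polygonalDrawing h
  have hdir (d : G.Dart) := P.segmentSystem.dir_ne_zero (P.first d)
  obtain ⟨σ, hσ⟩ := exists_perm_isNextCCW hdir fun _ _ => P.ccwAngle_first_lt
  refine ⟨σ, fun d d' => ⟨apply_eq_of_sameCycle (f := fun d : G.Dart => d.fst) fun d => (hσ d).1,
    sameCycle_of_isNextCCW hdir (fun _ _ => P.ccwAngle_first_lt) hσ⟩, fun ⟨e₀⟩ => ?_⟩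
  have : Nonempty V := ⟨P.tail e₀⟩
  have : Nonempty (Face σ) := ⟨⟦P.forward e₀⟧⟩
  have hnext (d : G.Dart) : P.segmentSystem.IsNext (P.first d) (P.first (σ d)) := by
    have hfst : (σ d).fst = d.fst := (hσ d).1
    refine ⟨by rw [P.src_first, P.src_first, hfst], fun o ho => ?_⟩
    rw [P.src_first] at ho
    obtain ⟨d', hd', rfl⟩ := P.exists_first_eq ho
    exact (hσ d).2 d' hd'
  have := Fintype.ofFinite G.edgeSet
  exact card_add_two_le_of_circulation P.tail P.head _ _ fun z hz => P.exists_faceValue hnext hz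

end Rotation

/-! ### Discharging -/

section Orbits

open Function

variable {D : Type*}

lemma two_mul_card_filter_le {f : D → D} (hf : Injective f) {A : Finset D}
    (hA : ∀ d ∈ A, f d ∈ A) {p : D → Prop} [DecidablePred p] (hp : ∀ d ∈ A, p d → ¬ p (f d)) :
    2 * (A.filter p).card ≤ A.card := by
  have hle : (A.filter p).card ≤ (A.filter (¬ p ·)).card := by
    refine Finset.card_le_card_of_injOn f (fun d hd => ?_) hf.injOn
    obtain ⟨hdA, hpd⟩ := Finset.mem_filter.1 hd
    exact Finset.mem_filter.2 ⟨hA d hdA, hp d hdA hpd⟩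
  have hadd := A.card_filter_add_card_filter_not p
  lia

lemma minimalPeriod_le_card {f : D → D} {A : Finset D} (hA : ∀ d ∈ A, f d ∈ A) {d : D}
    (hd : d ∈ A) : minimalPeriod f d ≤ A.card := by
  have hiter (k : ℕ) : f^[k] d ∈ A := by
    induction k with
    | zero => exact hd
    | succ k ih => exact iterate_succ_apply' f k d ▸ hA _ ih
  rw [← Finset.card_range (minimalPeriod f d)]
  exact Finset.card_le_card_of_injOn (f^[·] d) (fun k _ => hiter k) fun i hi j hj hij =>
    iterate_injOn_Iio_minimalPeriod (Finset.mem_range.1 hi) (Finset.mem_range.1 hj) hij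

lemma minimalPeriod_perm_apply [Finite D] (ψ : Equiv.Perm D) (d : D) :
    minimalPeriod ψ (ψ d) = minimalPeriod ψ d :=
  minimalPeriod_apply (ψ.injective.mem_periodicPts d)

variable {ψ : Equiv.Perm D}

/-- The cycles of `ψ` being faces and `τ` taking a side to the same side seen from the other
face, the side `d` discharges if its face has length at least five and the other one has length
three; the latter then receives one unit of charge across `d`. -/
def Discharges (ψ τ : Equiv.Perm D) (d : D) : Prop :=
  5 ≤ minimalPeriod ψ d ∧ minimalPeriod ψ (τ d) = 3

open Classical in
lemma eight_add_card_discharges_le {τ : Equiv.Perm D} (hτ : Involutive τ)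
    (hlen : ∀ d, 3 ≤ minimalPeriod ψ d)
    (hsep : ∀ d, minimalPeriod ψ (τ d) = 3 → minimalPeriod ψ (τ (ψ d)) ≠ 3)
    (htri : ∀ d, minimalPeriod ψ d = 3 →
      5 ≤ minimalPeriod ψ (τ d) ∨ 5 ≤ minimalPeriod ψ (τ (ψ d)))
    {A : Finset D} (hA : ∀ d ∈ A, ψ d ∈ A) {n : ℕ} (hn : ∀ d ∈ A, minimalPeriod ψ d = n)
    (hne : A.Nonempty) :
    8 + (A.filter (Discharges ψ τ)).card ≤
      2 * A.card + (A.filter fun d => Discharges ψ τ (τ d)).card := by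
  obtain ⟨d₀, hd₀⟩ := hne
  have hcard : n ≤ A.card := hn d₀ hd₀ ▸ minimalPeriod_le_card hA hd₀
  have hn₃ : 3 ≤ n := hn d₀ hd₀ ▸ hlen d₀
  have hout : 2 * (A.filter (Discharges ψ τ)).card ≤ A.card :=
    two_mul_card_filter_le ψ.injective hA fun d _ h h' => hsep d h.2 h'.2
  rcases le_or_gt 5 n with hn₅ | hn₅
  · lia
  have hout₀ : (A.filter (Discharges ψ τ)).card = 0 := by
    rw [Finset.card_eq_zero, Finset.filter_eq_empty_iff]
    exact fun d hd h => hn₅.not_ge (hn d hd ▸ h.1)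
  rcases (by lia : n = 3 ∨ 4 ≤ n) with rfl | hn₄
  · have hin : 2 * (A.filter fun d => ¬ Discharges ψ τ (τ d)).card ≤ A.card := by
      refine two_mul_card_filter_le ψ.injective hA fun d hd h h' => ?_
      rcases htri d (hn d hd) with h₅ | h₅
      · exact h ⟨h₅, by rw [hτ d, hn d hd]⟩
      · exact h' ⟨h₅, by rw [hτ (ψ d), hn _ (hA d hd)]⟩
    have hadd := A.card_filter_add_card_filter_not fun d => Discharges ψ τ (τ d)
    lia
  · lia

lemma four_mul_card_orbits_le [Finite D] {τ : Equiv.Perm D} (hτ : Involutive τ)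
    (hlen : ∀ d, 3 ≤ minimalPeriod ψ d)
    (hsep : ∀ d, minimalPeriod ψ (τ d) = 3 → minimalPeriod ψ (τ (ψ d)) ≠ 3)
    (htri : ∀ d, minimalPeriod ψ d = 3 →
      5 ≤ minimalPeriod ψ (τ d) ∨ 5 ≤ minimalPeriod ψ (τ (ψ d))) :
    4 * Nat.card (Quotient (Equiv.Perm.SameCycle.setoid ψ)) ≤ Nat.card D := by
  classical
  have := Fintype.ofFinite D
  have := Fintype.ofFinite (Quotient (Equiv.Perm.SameCycle.setoid ψ))
  let orbit (x : Quotient (Equiv.Perm.SameCycle.setoid ψ)) : Finset D := {d | ⟦d⟧ = x}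
  have hψ (d : D) : (⟦ψ d⟧ : Quotient (Equiv.Perm.SameCycle.setoid ψ)) = ⟦d⟧ :=
    Quotient.sound (Equiv.Perm.sameCycle_apply_left.2 (Equiv.Perm.SameCycle.refl ψ d))
  have hcharge (x) : 8 + ((orbit x).filter (Discharges ψ τ)).card ≤
      2 * (orbit x).card + ((orbit x).filter fun d => Discharges ψ τ (τ d)).card := by
    obtain ⟨d₀, rfl⟩ := Quotient.exists_rep x
    refine eight_add_card_discharges_le hτ hlen hsep htri (n := minimalPeriod ψ d₀)
      (fun d hd => ?_) (fun d hd => ?_) ⟨d₀, by simp [orbit]⟩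
    · rw [Finset.mem_filter_univ] at hd ⊢
      rw [hψ, hd]
    · exact apply_eq_of_sameCycle (minimalPeriod_perm_apply ψ)
        (Quotient.exact (Finset.mem_filter_univ d |>.1 hd))
  have hcount (p : D → Prop) : ∑ x, ((orbit x).filter p).card = (Finset.univ.filter p).card := by
    rw [Finset.card_eq_sum_card_fiberwise fun d _ =>
      Finset.mem_coe.2 (Finset.mem_univ (⟦d⟧ : Quotient (Equiv.Perm.SameCycle.setoid ψ)))]
    exact Finset.sum_congr rfl fun x _ => by rw [Finset.filter_comm]
  have hout : (Finset.univ.filter fun d => Discharges ψ τ (τ d)).card =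
      (Finset.univ.filter (Discharges ψ τ)).card := by
    rw [Finset.card_filter, Finset.card_filter]
    exact Equiv.sum_comp τ fun d => if Discharges ψ τ d then 1 else 0
  have horbit : ∑ x, (orbit x).card = Fintype.card D := by
    simpa using hcount fun _ => True
  have hsum := Finset.sum_le_sum fun x (_ : x ∈ Finset.univ) => hcharge x
  rw [Finset.sum_add_distrib, Finset.sum_add_distrib, ← Finset.mul_sum, Finset.sum_const,
    smul_eq_mul, Finset.card_univ, horbit, hcount, hcount, hout] at hsum
  rw [Nat.card_eq_fintype_card, Nat.card_eq_fintype_card]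
  lia

end Orbits

section TriangularFaces

open Function

variable {V : Type*}

/-- No two distinct triangles share a vertex, read off at vertices: a second triangle through
`a` has its vertices among those of the first one. -/
def TrianglesDisjoint (G : SimpleGraph V) : Prop :=
  ∀ a b c b' c', G.Adj a b → G.Adj b c → G.Adj c a → G.Adj a b' → G.Adj b' c' → G.Adj c' a →
    b' = b ∨ b' = c

/-- The pair `a`, `b` is an edge of a `4`-cycle of `G`. -/
def IsFourCycleEdge (G : SimpleGraph V) (a b : V) : Prop :=
  G.Adj a b ∧ ∃ c d, G.Adj b c ∧ G.Adj c d ∧ G.Adj d a ∧ a ≠ c ∧ b ≠ d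

/-- Every triangle of `G` has at most one edge that lies on `4`-cycles. -/
def TrianglesHaveAtMostOneFourCycleEdge (G : SimpleGraph V) : Prop :=
  ∀ a b c, G.Adj a b → G.Adj b c → G.Adj c a → IsFourCycleEdge G a b → ¬ IsFourCycleEdge G b c

variable {G : SimpleGraph V} {σ : Equiv.Perm G.Dart}

namespace IsRotationSystem

lemma fst_apply (hσ : IsRotationSystem σ) (d : G.Dart) : (σ d).fst = d.fst :=
  (hσ _ _).1 (Equiv.Perm.sameCycle_apply_left.2 (Equiv.Perm.SameCycle.refl σ d))

lemma fst_facePerm (hσ : IsRotationSystem σ) (d : G.Dart) : (facePerm σ d).fst = d.snd :=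
  hσ.fst_apply d.symm

lemma apply_apply_ne [Fintype V] [DecidableRel G.Adj] (hσ : IsRotationSystem σ) {d : G.Dart}
    (hdeg : 3 ≤ G.degree d.fst) : σ (σ d) ≠ d := by
  classical
  intro h
  have hstar : (Finset.univ.filter fun d' : G.Dart => d'.fst = d.fst) ⊆ {d, σ d} := by
    intro d' hd'
    have hinv (x : G.Dart) : (σ x ∈ ({d, σ d} : Finset G.Dart)) = (x ∈ ({d, σ d} : Finset _)) := by
      have hxd : σ x = d ↔ x = σ d :=
        ⟨fun hx => σ.injective (hx.trans h.symm), fun hx => hx ▸ h⟩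
      simp [hxd, or_comm]
    rw [← apply_eq_of_sameCycle hinv ((hσ d d').2 (Finset.mem_filter_univ d' |>.1 hd').symm)]
    exact Finset.mem_insert_self d _
  have hcard := (Finset.card_le_card hstar).trans Finset.card_le_two
  rw [G.dart_fst_fiber_card_eq_degree] at hcard
  lia

lemma snd_facePerm_ne (hσ : IsRotationSystem σ) (hσ₂ : ∀ d, σ (σ d) ≠ d) (d : G.Dart) :
    (facePerm σ d).snd ≠ d.fst := by
  intro h
  have hfix : σ d.symm = d.symm :=
    SimpleGraph.Dart.ext _ _ (Prod.ext (hσ.fst_apply d.symm) h)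
  exact hσ₂ d.symm (by rw [hfix, hfix])

lemma three_le_minimalPeriod [Finite G.Dart] (hσ : IsRotationSystem σ) (hσ₂ : ∀ d, σ (σ d) ≠ d)
    (d : G.Dart) : 3 ≤ minimalPeriod (facePerm σ) d := by
  have hpos := minimalPeriod_pos_of_mem_periodicPts ((facePerm σ).injective.mem_periodicPts d)
  have hper := iterate_minimalPeriod (f := facePerm σ) (x := d)
  by_contra! hlt
  obtain h | h : minimalPeriod (facePerm σ) d = 1 ∨ minimalPeriod (facePerm σ) d = 2 := by lia
  · replace hper : facePerm σ d = d := by rwa [h] at hper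
    exact d.fst_ne_snd (by rw [← hσ.fst_facePerm d, hper])
  · replace hper : facePerm σ (facePerm σ d) = d := by rwa [h] at hper
    exact hσ.snd_facePerm_ne hσ₂ d (by rw [← hσ.fst_facePerm (facePerm σ d), hper])

lemma adj_facePerm (hσ : IsRotationSystem σ) (d : G.Dart) :
    G.Adj d.snd (facePerm σ d).snd :=
  hσ.fst_facePerm d ▸ (facePerm σ d).adj

lemma adj_of_minimalPeriod_eq_three (hσ : IsRotationSystem σ) {d : G.Dart}
    (hd : minimalPeriod (facePerm σ) d = 3) : G.Adj (facePerm σ d).snd d.fst := by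
  have hper : facePerm σ (facePerm σ (facePerm σ d)) = d :=
    (hd ▸ isPeriodicPt_minimalPeriod _ d : IsPeriodicPt (facePerm σ) 3 d)
  have hadj := hσ.adj_facePerm (facePerm σ d)
  rwa [← hσ.fst_facePerm (facePerm σ (facePerm σ d)), hper] at hadj

lemma isFourCycleEdge_of_minimalPeriod_eq_four (hσ : IsRotationSystem σ)
    (hσ₂ : ∀ d, σ (σ d) ≠ d) {d : G.Dart} (hd : minimalPeriod (facePerm σ) d = 4) :
    IsFourCycleEdge G d.fst d.snd := by
  have hper : facePerm σ (facePerm σ (facePerm σ (facePerm σ d))) = d :=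
    (hd ▸ isPeriodicPt_minimalPeriod _ d : IsPeriodicPt (facePerm σ) 4 d)
  have hback := hσ.snd_facePerm_ne hσ₂ (facePerm σ d)
  rw [hσ.fst_facePerm] at hback
  have hadj := hσ.adj_facePerm (facePerm σ (facePerm σ d))
  rw [← hσ.fst_facePerm (facePerm σ (facePerm σ (facePerm σ d))), hper] at hadj
  exact ⟨d.adj, _, _, hσ.adj_facePerm d, hσ.adj_facePerm (facePerm σ d), hadj,
    (hσ.snd_facePerm_ne hσ₂ d).symm, hback.symm⟩

lemma minimalPeriod_symm_ne_three (hσ : IsRotationSystem σ) (hσ₂ : ∀ d, σ (σ d) ≠ d)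
    (hG : TrianglesDisjoint G) {d : G.Dart} (hd : minimalPeriod (facePerm σ) d = 3) :
    minimalPeriod (facePerm σ) d.symm ≠ 3 := by
  intro hd'
  have hper : facePerm σ (facePerm σ (facePerm σ d)) = d :=
    (hd ▸ isPeriodicPt_minimalPeriod _ d : IsPeriodicPt (facePerm σ) 3 d)
  rcases hG d.fst d.snd (facePerm σ d).snd (facePerm σ d.symm).snd d.snd d.adj
      (hσ.adj_facePerm d) (hσ.adj_of_minimalPeriod_eq_three hd) (hσ.adj_facePerm d.symm)
      (hσ.adj_of_minimalPeriod_eq_three hd') d.adj.symm with h | h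
  · exact hσ.snd_facePerm_ne hσ₂ d.symm h
  · have hσd : σ d = (facePerm σ (facePerm σ d)).symm := by
      refine SimpleGraph.Dart.ext _ _ (Prod.ext ?_ ?_)
      · rw [hσ.fst_apply]
        exact (congrArg (·.fst) hper).symm.trans (hσ.fst_facePerm _)
      · exact h.trans (hσ.fst_facePerm (facePerm σ d)).symm
    exact hσ₂ d (by rw [hσd, ← facePerm_apply, hper])

/-- If the faces across `d` and across the next side both were triangles, the degree of the
vertex between these sides would be two. -/
lemma minimalPeriod_symm_facePerm_ne_three (hσ : IsRotationSystem σ) (hσ₂ : ∀ d, σ (σ d) ≠ d)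
    (hG : TrianglesDisjoint G) {d : G.Dart} (hd : minimalPeriod (facePerm σ) d.symm = 3) :
    minimalPeriod (facePerm σ) (facePerm σ d).symm ≠ 3 := by
  intro hd'
  have hadj := hσ.adj_facePerm (facePerm σ d).symm
  have hadj' := hσ.adj_of_minimalPeriod_eq_three hd'
  change G.Adj (facePerm σ d).fst _ at hadj
  rw [hσ.fst_facePerm] at hadj
  rcases hG d.snd (facePerm σ d).snd (facePerm σ (facePerm σ d).symm).snd d.fst
      (facePerm σ d.symm).snd (hσ.adj_facePerm d) hadj'.symm hadj.symm d.adj.symm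
      (hσ.adj_facePerm d.symm) (hσ.adj_of_minimalPeriod_eq_three hd) with h | h
  · exact hσ.snd_facePerm_ne hσ₂ d h.symm
  · refine hσ₂ d.symm (SimpleGraph.Dart.ext _ _ (Prod.ext ?_ h.symm))
    rw [hσ.fst_apply, hσ.fst_apply]

lemma four_mul_card_face_le [Finite G.Dart] (hσ : IsRotationSystem σ) (hσ₂ : ∀ d, σ (σ d) ≠ d)
    (hdisjoint : TrianglesDisjoint G) (hfour : TrianglesHaveAtMostOneFourCycleEdge G) :
    4 * Nat.card (Face σ) ≤ Nat.card G.Dart := by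
  refine four_mul_card_orbits_le (τ := SimpleGraph.Dart.symm_involutive.toPerm)
    SimpleGraph.Dart.symm_involutive (hσ.three_le_minimalPeriod hσ₂)
    (fun d => hσ.minimalPeriod_symm_facePerm_ne_three hσ₂ hdisjoint) fun d hd => ?_
  change 5 ≤ minimalPeriod (facePerm σ) d.symm ∨ 5 ≤ minimalPeriod (facePerm σ) (facePerm σ d).symm
  by_contra! hlt
  have hedge (d : G.Dart) (hd : minimalPeriod (facePerm σ) d = 3)
      (hd' : minimalPeriod (facePerm σ) d.symm < 5) : IsFourCycleEdge G d.snd d.fst := by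
    have hge := hσ.three_le_minimalPeriod hσ₂ d.symm
    have hne := hσ.minimalPeriod_symm_ne_three hσ₂ hdisjoint hd
    exact hσ.isFourCycleEdge_of_minimalPeriod_eq_four hσ₂ (d := d.symm) (by lia)
  have hnext := hedge _ ((minimalPeriod_perm_apply (facePerm σ) d).trans hd) hlt.2
  rw [hσ.fst_facePerm] at hnext
  exact hfour _ _ _ (hσ.adj_facePerm d).symm d.adj.symm
    (hσ.adj_of_minimalPeriod_eq_three hd).symm hnext (hedge d hd hlt.1)

end IsRotationSystem

end TriangularFaces

section Sparsity

variable {V : Type*} {G : SimpleGraph V}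

lemma isPlanar_induce (h : G.IsPlanar) (s : Set V) : (G.induce s).IsPlanar := by
  obtain ⟨D⟩ := h
  have hmap (e) (he : e ∈ (G.induce s).edgeSet) : e.map Subtype.val ∈ G.edgeSet := by
    induction e using Sym2.ind with
    | _ u v => exact he
  refine ⟨{ point := fun v => D.point v
            arc := fun e => D.arc (e.map Subtype.val)
            point_injective := D.point_injective.comp Subtype.val_injective
            isPolygonalArc_arc := fun u v huv => D.isPolygonalArc_arc u v huv
            mem_of_point_mem_arc := fun e he v hv => ?_
            exists_of_mem_arc_inter := fun e he f hf hef z hz => ?_ }⟩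
  · obtain ⟨w, hw, hwv⟩ := Sym2.mem_map.1 (D.mem_of_point_mem_arc _ (hmap e he) v hv)
    rwa [← Subtype.ext hwv]
  · obtain ⟨v, hve, hvf, hvz⟩ := D.exists_of_mem_arc_inter _ (hmap e he) _ (hmap f hf)
      (fun h => hef (Sym2.map.injective Subtype.val_injective h)) z hz
    obtain ⟨w, hwe, rfl⟩ := Sym2.mem_map.1 hve
    obtain ⟨w', hwf, hww'⟩ := Sym2.mem_map.1 hvf
    exact ⟨w, hwe, Subtype.ext hww' ▸ hwf, hvz⟩

lemma TrianglesDisjoint.induce (h : TrianglesDisjoint G) (s : Set V) :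
    TrianglesDisjoint (G.induce s) := fun a b c b' c' hab hbc hca hab' hbc' hca' =>
  (h a b c b' c' hab hbc hca hab' hbc' hca').imp Subtype.ext Subtype.ext

lemma IsFourCycleEdge.of_induce {s : Set V} {a b : s} (h : IsFourCycleEdge (G.induce s) a b) :
    IsFourCycleEdge G a b := by
  obtain ⟨hab, c, d, hbc, hcd, hda, hac, hbd⟩ := h
  exact ⟨hab, c, d, hbc, hcd, hda, Subtype.coe_ne_coe.2 hac, Subtype.coe_ne_coe.2 hbd⟩

lemma TrianglesHaveAtMostOneFourCycleEdge.induce (h : TrianglesHaveAtMostOneFourCycleEdge G)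
    (s : Set V) : TrianglesHaveAtMostOneFourCycleEdge (G.induce s) :=
  fun a b c hab hbc hca hab' hbc' => h a b c hab hbc hca hab'.of_induce hbc'.of_induce

lemma card_edgeSet_le_of_three_le_degree [Fintype V] [DecidableRel G.Adj] (hplanar : G.IsPlanar)
    (hdisjoint : TrianglesDisjoint G) (hfour : TrianglesHaveAtMostOneFourCycleEdge G)
    (hdeg : ∀ v, 3 ≤ G.degree v) : Nat.card G.edgeSet ≤ 2 * Nat.card V := by
  classical
  rcases isEmpty_or_nonempty G.edgeSet with hempty | hnonempty
  · simp
  obtain ⟨σ, hσ, heuler⟩ := exists_isRotationSystem hplanar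
  have hfaces := hσ.four_mul_card_face_le (fun d => hσ.apply_apply_ne (hdeg d.fst)) hdisjoint hfour
  have hdarts : Nat.card G.Dart = 2 * Nat.card G.edgeSet := by
    rw [Nat.card_eq_fintype_card, G.dart_card_eq_twice_card_edges, Nat.card_eq_fintype_card,
      ← SimpleGraph.edgeFinset_card]
  have := heuler hnonempty
  lia

lemma card_edgeSet_le [Finite V] (hplanar : G.IsPlanar) (hdisjoint : TrianglesDisjoint G)
    (hfour : TrianglesHaveAtMostOneFourCycleEdge G) : Nat.card G.edgeSet ≤ 2 * Nat.card V := by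
  classical
  induction hn : Nat.card V using Nat.strong_induction_on generalizing V with
  | _ n ih =>
    subst hn
    have := Fintype.ofFinite V
    by_cases! hdeg : ∀ v, 3 ≤ G.degree v
    · exact card_edgeSet_le_of_three_le_degree hplanar hdisjoint hfour hdeg
    obtain ⟨v, hv⟩ := hdeg
    have hcard : Nat.card ({v}ᶜ : Set V) + 1 = Nat.card V := by
      rw [Nat.card_coe_set_eq, add_comm, ← Set.ncard_singleton v, Set.ncard_add_ncard_compl]
    have hrest := ih _ (by lia) (isPlanar_induce hplanar {v}ᶜ) (hdisjoint.induce _)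
      (hfour.induce _) rfl
    have hdelete := G.card_edgeFinset_induce_compl_singleton v
    rw [G.card_edgeFinset_deleteIncidenceSet v] at hdelete
    simp only [Nat.card_eq_fintype_card, ← SimpleGraph.edgeFinset_card] at *
    lia

end Sparsity

section Choosability

variable {V : Type*} {G : SimpleGraph V}

/-- By Hall's theorem the edges can be assigned to their end vertices, at most `k` to each. -/
lemma exists_injective_of_card_edgeSet_le {k : ℕ}
    (h : ∀ s : Finset V, Nat.card (G.induce (s : Set V)).edgeSet ≤ k * s.card) :
    ∃ f : G.edgeSet → V × Fin k, Function.Injective f ∧ ∀ e : G.edgeSet, (f e).1 ∈ e.1 := by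
  classical
  suffices hall : ∀ A : Finset G.edgeSet,
      A.card ≤ (A.biUnion fun e => e.1.toFinset ×ˢ (Finset.univ : Finset (Fin k))).card by
    obtain ⟨f, hf, hfe⟩ := (Finset.all_card_le_biUnion_card_iff_exists_injective _).1 hall
    exact ⟨f, hf, fun e => Sym2.mem_toFinset.1 (Finset.mem_product.1 (hfe e)).1⟩
  intro A
  let S : Finset V := A.biUnion fun e => e.1.toFinset
  have hunion : (A.biUnion fun e => e.1.toFinset ×ˢ (Finset.univ : Finset (Fin k))) =
      S ×ˢ Finset.univ := by
    ext x
    simp [S]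
  have hsub : A.image Subtype.val ⊆
      (G.induce (S : Set V)).edgeFinset.image (Sym2.map Subtype.val) := by
    intro e he
    obtain ⟨⟨e, heG⟩, heA, rfl⟩ := Finset.mem_image.1 he
    induction e using Sym2.ind with
    | _ u v =>
      have hS (w : V) (hw : w ∈ s(u, v)) : w ∈ S :=
        Finset.mem_biUnion.2 ⟨_, heA, Sym2.mem_toFinset.2 hw⟩
      exact Finset.mem_image.2
        ⟨s(⟨u, hS u (Sym2.mem_mk_left u v)⟩, ⟨v, hS v (Sym2.mem_mk_right u v)⟩),
          SimpleGraph.mem_edgeFinset.2 heG, rfl⟩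
  calc A.card = (A.image Subtype.val).card :=
        (Finset.card_image_of_injective A Subtype.val_injective).symm
    _ ≤ (G.induce (S : Set V)).edgeFinset.card :=
        (Finset.card_le_card hsub).trans Finset.card_image_le
    _ ≤ k * S.card := by
        rw [SimpleGraph.edgeFinset_card, ← Nat.card_eq_fintype_card]
        exact h S
    _ = _ := by rw [hunion, Finset.card_product, Finset.card_fin, mul_comm]

/-- Colour every vertex with a colour of its list not occurring on the edges assigned to it. -/
lemma adaptablyChoosable_of_injective {k : ℕ} {f : G.edgeSet → V × Fin k}
    (hf : Function.Injective f) (hmem : ∀ e : G.edgeSet, (f e).1 ∈ e.1) :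
    G.AdaptablyChoosable (k + 1) := by
  intro F L hL
  let forbidden (v : V) : Finset ℤ :=
    Finset.univ.image fun i => Function.extend f F 0 (v, i)
  have hexists (v : V) : ∃ x ∈ L v, x ∉ forbidden v := by
    refine Finset.exists_mem_notMem_of_card_lt_card ((Nat.lt_succ_of_le ?_).trans_le (hL v))
    exact Finset.card_image_le.trans (Finset.card_fin k).le
  choose c hcL hc using hexists
  have hcF (e : G.edgeSet) : c (f e).1 ≠ F e := fun h =>
    hc (f e).1 (Finset.mem_image.2 ⟨(f e).2, Finset.mem_univ _, by rw [h, ← hf.extend_apply F 0]⟩)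
  refine ⟨c, fun u v huv => ?_, hcL⟩
  by_cases hcuv : c u = c v
  · have hcv : c (f ⟨s(u, v), huv⟩).1 = c v := by
      rcases Sym2.mem_iff.1 (hmem ⟨s(u, v), huv⟩) with h | h
      · rw [h, hcuv]
      · rw [h]
    exact Or.inr (hcv ▸ hcF ⟨s(u, v), huv⟩)
  · exact Or.inl hcuv

/-- Colour every edge with the only colour that the lists of its end vertices can share. -/
lemma separatedChoosable_of_adaptablyChoosable {k : ℕ} (h : G.AdaptablyChoosable k) :
    G.SeparatedChoosable k 1 := by
  intro L hL hsep
  have hexists (e : G.edgeSet) : ∃ m : ℤ, ∀ x, (∀ v ∈ e.1, x ∈ L v) → x = m := by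
    obtain ⟨e, he⟩ := e
    induction e using Sym2.ind with
    | _ u v =>
      obtain ⟨m, hm⟩ := Finset.card_le_one_iff_subset_singleton.1 (hsep u v he)
      exact ⟨m, fun x hx => Finset.mem_singleton.1 (hm (Finset.mem_inter.2
        ⟨hx u (Sym2.mem_mk_left u v), hx v (Sym2.mem_mk_right u v)⟩))⟩
  choose F hF using hexists
  obtain ⟨c, hc, hcL⟩ := h F L hL
  refine ⟨SimpleGraph.Coloring.mk c fun {u v} huv heq => ?_, hcL⟩
  refine (hc u v huv).elim (· heq) (· (hF ⟨s(u, v), huv⟩ (c v) fun w hw => ?_))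
  rcases Sym2.mem_iff.1 hw with rfl | rfl
  · exact heq ▸ hcL w
  · exact hcL w

end Choosability

section ShortCycles

open SimpleGraph

variable {V : Type*} {G : SimpleGraph V} {a b c d : V}

/-- The closed walk along a triangle. -/
def triangleWalk (hab : G.Adj a b) (hbc : G.Adj b c) (hca : G.Adj c a) : G.Walk a a :=
  .cons hab (.cons hbc (.cons hca .nil))

/-- The closed walk along a `4`-cycle. -/
def fourCycleWalk (hab : G.Adj a b) (hbc : G.Adj b c) (hcd : G.Adj c d) (hda : G.Adj d a) :
    G.Walk a a :=
  .cons hab (.cons hbc (.cons hcd (.cons hda .nil)))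

lemma isTriangle_triangleWalk (hab : G.Adj a b) (hbc : G.Adj b c) (hca : G.Adj c a) :
    IsTriangle (triangleWalk hab hbc hca).toSubgraph := by
  refine ⟨a, triangleWalk hab hbc hca, ?_, rfl, rfl⟩
  simp [triangleWalk, Walk.cons_isCycle_iff, hab.ne, hab.ne', hbc.ne, hca.ne, hca.ne']

lemma isCycleOfLength_fourCycleWalk (hab : G.Adj a b) (hbc : G.Adj b c) (hcd : G.Adj c d)
    (hda : G.Adj d a) (hac : a ≠ c) (hbd : b ≠ d) :
    IsCycleOfLength (fourCycleWalk hab hbc hcd hda).toSubgraph 4 := by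
  refine ⟨a, fourCycleWalk hab hbc hcd hda, ?_, rfl, rfl⟩
  simp [fourCycleWalk, Walk.cons_isCycle_iff, hab.ne, hab.ne', hbc.ne, hcd.ne, hda.ne, hda.ne',
    hac, hac.symm, hbd]

lemma trianglesDisjoint_of_noIntersectingTriangles (h : G.NoIntersectingTriangles) :
    TrianglesDisjoint G := by
  intro a b c b' c' hab hbc hca hab' hbc' hca'
  have heq : (triangleWalk hab hbc hca).toSubgraph = (triangleWalk hab' hbc' hca').toSubgraph := by
    by_contra hne
    exact h _ _ (isTriangle_triangleWalk hab hbc hca) (isTriangle_triangleWalk hab' hbc' hca') hne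
      ⟨a, by simp [triangleWalk], by simp [triangleWalk]⟩
  have hb' : b' ∈ (triangleWalk hab hbc hca).toSubgraph.verts := by
    rw [heq]
    simp [triangleWalk]
  simpa [triangleWalk, hab'.ne', or_comm] using hb'

lemma trianglesHaveAtMostOneFourCycleEdge (htri : G.NoIntersectingTriangles)
    (hfour : G.TrianglesAdjacentToAtMostOneFourCycle) :
    TrianglesHaveAtMostOneFourCycleEdge G := by
  rintro a b c hab hbc hca ⟨-, p, q, hbp, hpq, hqa, hap, hbq⟩ ⟨-, r, s, hcr, hrs, hsb, hbr, hcs⟩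
  have heq := hfour _ (isTriangle_triangleWalk hab hbc hca) _ _
    (isCycleOfLength_fourCycleWalk hab hbp hpq hqa hap hbq)
    (isCycleOfLength_fourCycleWalk hbc hcr hrs hsb hbr hcs)
    ⟨s(a, b), by simp [triangleWalk], by simp [fourCycleWalk]⟩
    ⟨s(b, c), by simp [triangleWalk], by simp [fourCycleWalk]⟩
  have hmem : s(b, c) ∈ (fourCycleWalk hab hbp hpq hqa).toSubgraph.edgeSet := by
    rw [heq]
    simp [fourCycleWalk]
  have hcp : c = p := by
    simpa [fourCycleWalk, hab.ne', hbp.ne, hbq, hca.ne] using hmem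
  subst hcp
  rcases trianglesDisjoint_of_noIntersectingTriangles htri a c q b c hca.symm hpq hqa hab hbc hca
    with h | h
  · exact hbc.ne h
  · exact hbq h

end ShortCycles

theorem theorem3p3_general {V : Type*} (G : SimpleGraph V) (hplanar : G.IsPlanar)
    (htri : G.NoIntersectingTriangles) (hfour : TrianglesHaveAtMostOneFourCycleEdge G) :
    G.adaptableChoiceNumber ≤ 3 ∧ G.SeparatedChoosable 3 1 := by
  have hdisjoint := trianglesDisjoint_of_noIntersectingTriangles htri
  have hsparse (s : Finset V) : Nat.card (G.induce (s : Set V)).edgeSet ≤ 2 * s.card := by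
    rw [← Nat.card_eq_finsetCard]
    exact card_edgeSet_le (isPlanar_induce hplanar _) (hdisjoint.induce _) (hfour.induce _)
  obtain ⟨f, hf, hmem⟩ := exists_injective_of_card_edgeSet_le hsparse
  have hchoosable := adaptablyChoosable_of_injective hf hmem
  exact ⟨iInf₂_le 3 hchoosable, separatedChoosable_of_adaptablyChoosable hchoosable⟩

theorem theorem3p3 {V : Type*} [Finite V] (G : SimpleGraph V) (hplanar : G.IsPlanar)
    (htri : G.NoIntersectingTriangles)
    (hfour : G.TrianglesAdjacentToAtMostOneFourCycle) :
    G.adaptableChoiceNumber ≤ 3 ∧ G.SeparatedChoosable 3 1 :=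
  theorem3p3_general G hplanar htri (trianglesHaveAtMostOneFourCycleEdge htri hfour)
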